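/- A \emph{rendez-vous protocol} is a tuple $\mathcal{P}=(Q,\Sigma,q_{in},q_f,T)$ where $Q$ is a finite set of states, $\Sigma$ is a finite alphabet of messages, $q_{in},q_f\in Q$ are the initial and the final state, and $T\subseteq Q\times(\{\tau\}\cup\{!m,?m\mid m\in\Sigma\})\times Q$ is a set of transitions. A \emph{configuration} is a non-empty finite multiset $C$ over $Q$, $C(q)$ being the number of processes in state $q$. It is \emph{initial} if $C(q)=0$ for all $q\neq q_{in}$. There is a step $C\to C'$ if one of the following holds: (internal) there is $(q,\tau,q')\in T$ with $C(q)>0$ and $C'=C-\{q\}+\{q'\}$; (rendez-vous) there are a message $m$ and $(q_1,!m,q_1'),(q_2,?m,q_2')\in T$ such that the multiset $\{q_1,q_2\}$ is contained in $C$ and $C'=C-\{q_1,q_2\}+\{q_1',q_2'\}$; (non-blocking request) there are a message $m$ and $(q_1,!m,q_1')\in T$ with $C(q_1)>0$ such that $(C-\{q_1\})(q_2)=0$ for every $(q_2,?m,q_2')\in T$, and $C'=C-\{q_1\}+\{q_1'\}$. Let $\to^*$ be the reflexive and transitive closure of $\to$. The \emph{synchronization problem} \textsc{Synchro} takes a protocol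 $\mathcal{P}$ as input and asks whether there are an initial configuration $C_0$ (of any size) and a configuration $C_f$ with $C_f(q)=0$ for all $q\neq q_f$ such that $C_0\to^* C_f$. A protocol is \emph{wait-only} if $Q$ can be partitioned into a set $Q_A$ of active states, with $q_{in}\in Q_A$, and a set $Q_W$ of waiting states such that no transition $(q,?m,q')\in T$ has $q\in Q_A$ and no transition $(q,!m,q')\in T$ or $(q,\tau,q')\in T$ has $q\in Q_W$. \textbf{Theorem.} \textsc{Synchro} is undecidable. It remains undecidable when restricted to wait-only protocols: there is no algorithm that, for every wait-only protocol given as input, halts and answers correctly whether it is a positive instance of \textsc{Synchro}. -/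

import Mathlib

/-- The primitives over a message alphabet `M`: the internal action `τ`, the request `!m`
and the reception `?m`. -/
inductive Primitive (M : Type) : Type
  | tau : Primitive M
  | send (m : M) : Primitive M
  | recv (m : M) : Primitive M

/-- The labels of steps between configurations: `τ`, a message `m`, or `nb(m)`. -/
inductive StepLabel (M : Type) : Type
  | tau : StepLabel M
  | rdv (m : M) : StepLabel M
  | nb (m : M) : StepLabel M

/-- A rendez-vous protocol with set of states `Q` and message alphabet `M` (both are finite
wherever protocols are used below). -/
structure Protocol (Q M : Type) : Type where
  qin : Q
  qf : Q
  T : Set (Q × Primitive M × Q)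

namespace Protocol

variable {Q M : Type}

/-- The labelled steps of the non-blocking semantics. Configurations are multisets of states. -/
inductive LabelledStep [DecidableEq Q] (P : Protocol Q M) :
    Multiset Q → StepLabel M → Multiset Q → Prop
  /-- internal -/
  | internal {C : Multiset Q} {q q' : Q} (ht : (q, Primitive.tau, q') ∈ P.T)
      (hq : 0 < C.count q) :
      LabelledStep P C StepLabel.tau (C - {q} + {q'})
  /-- rendez-vous: two distinct processes, one in `q₁` and one in `q₂`, synchronize on `m` -/
  | rendezvous {C : Multiset Q} {m : M} {q₁ q₁' q₂ q₂' : Q}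
      (hs : (q₁, Primitive.send m, q₁') ∈ P.T) (hr : (q₂, Primitive.recv m, q₂') ∈ P.T)
      (hC : ({q₁, q₂} : Multiset Q) ≤ C) :
      LabelledStep P C (StepLabel.rdv m) (C - {q₁, q₂} + {q₁', q₂'})
  /-- non-blocking request: nobody but the sender is in a state from which `m` can be received -/
  | nonblocking {C : Multiset Q} {m : M} {q₁ q₁' : Q}
      (hs : (q₁, Primitive.send m, q₁') ∈ P.T) (hq : 0 < C.count q₁)
      (hn : ∀ q₂ q₂' : Q, (q₂, Primitive.recv m, q₂') ∈ P.T → (C - {q₁}).count q₂ = 0) :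
      LabelledStep P C (StepLabel.nb m) (C - {q₁} + {q₁'})

/-- One step, whatever its label. -/
def Step [DecidableEq Q] (P : Protocol Q M) (C C' : Multiset Q) : Prop :=
  ∃ a : StepLabel M, P.LabelledStep C a C'

/-- Initial configurations: non-empty, with all processes in `qin`. -/
def IsInitial [DecidableEq Q] (P : Protocol Q M) (C : Multiset Q) : Prop :=
  C ≠ 0 ∧ ∀ q : Q, q ≠ P.qin → C.count q = 0

/-- Configurations (non-empty) with all processes in `qf`. -/
def IsAllFinal [DecidableEq Q] (P : Protocol Q M) (C : Multiset Q) : Prop :=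
  C ≠ 0 ∧ ∀ q : Q, q ≠ P.qf → C.count q = 0

/-- `P` is a positive instance of the synchronization problem. -/
def Synchro [DecidableEq Q] (P : Protocol Q M) : Prop :=
  ∃ C₀ Cf : Multiset Q, P.IsInitial C₀ ∧ P.IsAllFinal Cf ∧ Relation.ReflTransGen P.Step C₀ Cf

/-- Wait-only protocols: the states split into active states, with no outgoing reception, and
waiting states, with no outgoing request or internal action; `qin` is active. -/
def WaitOnly (P : Protocol Q M) : Prop :=
  ∃ QA QW : Set Q, QA ∪ QW = Set.univ ∧ Disjoint QA QW ∧ P.qin ∈ QA ∧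
    (∀ q ∈ QA, ∀ (m : M) (q' : Q), (q, Primitive.recv m, q') ∉ P.T) ∧
    (∀ q ∈ QW, (∀ (m : M) (q' : Q), (q, Primitive.send m, q') ∉ P.T) ∧
      ∀ q' : Q, (q, Primitive.tau, q') ∉ P.T)

end Protocol

/-- Codes of primitives over the alphabet `{0, …, k - 1}`: `none` for `τ`, `some (true, m)` for `!m`,
`some (false, m)` for `?m`. -/
def Primitive.code {k : ℕ} : Primitive (Fin k) → Option (Bool × ℕ)
  | .tau => none
  | .send m => some (true, m)
  | .recv m => some (false, m)

/-- Raw finite descriptions `(n, k, qin, qf, l)` of protocols: the number `n` of states, the number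
`k` of messages, the initial state, the final state and the list of transitions. -/
abbrev RawProtocol : Type :=
  ℕ × ℕ × ℕ × ℕ × List (ℕ × Option (Bool × ℕ) × ℕ)

namespace RawProtocol

/-- The number of states. -/
def numStates (c : RawProtocol) : ℕ := c.1

/-- The number of messages. -/
def numMessages (c : RawProtocol) : ℕ := c.2.1

/-- The initial state. -/
def qin (c : RawProtocol) : ℕ := c.2.2.1

/-- The final state. -/
def qf (c : RawProtocol) : ℕ := c.2.2.2.1

/-- The list of transitions. -/
def transitions (c : RawProtocol) : List (ℕ × Option (Bool × ℕ) × ℕ) := c.2.2.2.2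

/-- All states that occur are below `n` and all messages that occur are below `k`. -/
def Valid (c : RawProtocol) : Prop :=
  c.qin < c.numStates ∧ c.qf < c.numStates ∧
    ∀ t ∈ c.transitions, t.1 < c.numStates ∧ t.2.2 < c.numStates ∧
      ∀ p ∈ t.2.1, p.2 < c.numMessages

instance : DecidablePred Valid := fun c =>
  inferInstanceAs (Decidable (_ ∧ _ ∧ ∀ t ∈ c.transitions, _ ∧ _ ∧ ∀ p ∈ t.2.1, _))

theorem primrecPred_valid : PrimrecPred Valid := by
  have hn : Primrec numStates := Primrec.fst
  have hk : Primrec numMessages := Primrec.fst.comp Primrec.snd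
  have hi : Primrec qin := Primrec.fst.comp (Primrec.snd.comp Primrec.snd)
  have hf : Primrec qf := Primrec.fst.comp (Primrec.snd.comp (Primrec.snd.comp Primrec.snd))
  have hl : Primrec transitions :=
    Primrec.snd.comp (Primrec.snd.comp (Primrec.snd.comp Primrec.snd))
  have hopt : PrimrecRel fun (t : ℕ × Option (Bool × ℕ) × ℕ) (c : RawProtocol) =>
      ∀ p ∈ t.2.1, p.2 < c.numMessages := by
    have h : Primrec fun x : (ℕ × Option (Bool × ℕ) × ℕ) × RawProtocol =>
        (Option.casesOn x.1.2.1 true fun p => decide (p.2 < x.2.numMessages) : Bool) :=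
      Primrec.option_casesOn (Primrec.fst.comp (Primrec.snd.comp Primrec.fst))
        (Primrec.const true)
        (Primrec.nat_lt.comp (Primrec.snd.comp Primrec.snd)
          (hk.comp (Primrec.snd.comp Primrec.fst))).decide
    refine (Primrec.eq.comp h (Primrec.const true)).of_eq ?_
    rintro ⟨⟨q, o, q'⟩, c⟩
    cases o <;> simp
  have hrel : PrimrecRel fun (t : ℕ × Option (Bool × ℕ) × ℕ) (c : RawProtocol) =>
      t.1 < c.numStates ∧ t.2.2 < c.numStates ∧ ∀ p ∈ t.2.1, p.2 < c.numMessages :=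
    (Primrec.nat_lt.comp (Primrec.fst.comp Primrec.fst) (hn.comp Primrec.snd)).and
      ((Primrec.nat_lt.comp (Primrec.snd.comp (Primrec.snd.comp Primrec.fst))
        (hn.comp Primrec.snd)).and hopt)
  exact (Primrec.nat_lt.comp hi hn).and
    ((Primrec.nat_lt.comp hf hn).and (hrel.forall_mem_list.comp hl Primrec.id))

end RawProtocol

/-- The inputs of the decision problems on protocols: finite descriptions of protocols. Up to
renaming of states and messages, every protocol with finitely many states and messages is described
by one of them. -/
abbrev ProtocolInput : Type := {c : RawProtocol // c.Valid}

instance : Primcodable ProtocolInput := Primcodable.subtype RawProtocol.primrecPred_valid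

namespace ProtocolInput

/-- The protocol that an input describes. -/
def toProtocol (I : ProtocolInput) :
    Protocol (Fin I.val.numStates) (Fin I.val.numMessages) where
  qin := ⟨I.val.qin, I.property.1⟩
  qf := ⟨I.val.qf, I.property.2.1⟩
  T := {t | ((t.1 : ℕ), t.2.1.code, (t.2.2 : ℕ)) ∈ I.val.transitions}

end ProtocolInput

/-- The problem `p` is decidable on the instances in `D`: some algorithm halts with the correct
answer on each instance in `D` (nothing is asked of it on other inputs). -/
def DecidableOn {α : Type} [Primcodable α] (D : Set α) (p : α → Prop) : Prop :=
  ∃ f : α →. Bool, Partrec f ∧ ∀ a ∈ D, ∃ b : Bool, f a = Part.some b ∧ (b = true ↔ p a)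

/-!
The halting problem is reduced to `Synchro` for wait-only protocols by way of counter machines.

A program `c` halts on `0` if and only if a fixed primitive recursive function `haltingTest` takes
the value `0` at `(encode c, k)` for some `k`. Primitive recursive functions are computed by while
programs (`computes_of_primrec'`), which compile to counter machines given by lists of edges. One
program `P` thus yields machines `searchMachine P m` that load `m`, guess `k`, run `P` and reach
their final location if and only if the result is `0`. Only a chain of `m` increments depends on
`m`, so that the protocols that simulate these machines are computed from `m` by a primitive
recursive function.

The protocol `simulator` represents the value of the register `x` by the number of processes
waiting in `unit x`, and the location of the machine by a leader. Increments and decrements are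
requests of the leader, followed by an acknowledgement of the process that joins or leaves
`unit x`: a request without a receiver leaves the leader waiting for ever. A zero test is a
non-blocking request that takes a process in `unit x`, if there is one, to the dead state `sink`. No state has
both receptions and other transitions (`simulator_waitOnly`).

What has to be excluded is that several leaders work on the same registers. A leader starts only
by a rendez-vous with a process that becomes its warden and waits until it is released. The
request by which a process becomes a leader is received by wardens, and by leaders that have not
yet started, who then move to `sink`; so nobody can be elected without such a loss while a leader
is at work. Wardens, the pool and the registers reach `qf` only when a leader releases them at the
final location. Hence the invariant `Faithful`, preserved until a leader gets there or a process
is lost (`Faithful.step`): there is at most one leader, and its run is a run of the machine.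
Conversely, a run of the machine is simulated by one leader, one warden and enough processes in
the pool (`synchro_of_reaches`).
-/

namespace CounterMachine

open Function Relation

/-! ### Counter machines -/

/-- The instructions on the edges of a counter machine: no operation, increment, decrement of a
positive register, and zero test. -/
inductive Op : Type
  | nop : Op
  | inc (x : ℕ) : Op
  | dec (x : ℕ) : Op
  | zero (x : ℕ) : Op

/-- The effect of an instruction on the registers; `dec x` is blocked at `0`, and `zero x` is
blocked elsewhere. -/
def Op.Exec : Op → (ℕ → ℕ) → (ℕ → ℕ) → Prop
  | .nop, σ, σ' => σ' = σ
  | .inc x, σ, σ' => σ' = update σ x (σ x + 1)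
  | .dec x, σ, σ' => 0 < σ x ∧ σ' = update σ x (σ x - 1)
  | .zero x, σ, σ' => σ x = 0 ∧ σ' = σ

/-- An edge of a counter machine: source location, instruction, target location. -/
abbrev Edge : Type := ℕ × Op × ℕ

/-- One step of the counter machine with edges `E`, between pairs of a location and a store. -/
def Step (E : List Edge) (c d : ℕ × (ℕ → ℕ)) : Prop :=
  ∃ op : Op, (c.1, op, d.1) ∈ E ∧ op.Exec c.2 d.2

/-- Reachability in the counter machine with edges `E`. -/
abbrev Reaches (E : List Edge) : ℕ × (ℕ → ℕ) → ℕ × (ℕ → ℕ) → Prop := ReflTransGen (Step E)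

/-! ### While programs and their compilation -/

/-- While programs over registers indexed by `ℕ`; `loop x P` stands for
`while x > 0 do (x := x - 1; P)`. -/
inductive Prog : Type
  | skip : Prog
  | inc (x : ℕ) : Prog
  | seq (P Q : Prog) : Prog
  | loop (x : ℕ) (P : Prog) : Prog

/-- The big-step semantics of while programs: `Exec P σ σ'` if `P`, started with the store `σ`,
terminates with the store `σ'`. -/
inductive Exec : Prog → (ℕ → ℕ) → (ℕ → ℕ) → Prop
  | skip (σ) : Exec .skip σ σ
  | inc (x σ) : Exec (.inc x) σ (update σ x (σ x + 1))
  | seq {P Q σ₁ σ₂ σ₃} : Exec P σ₁ σ₂ → Exec Q σ₂ σ₃ → Exec (.seq P Q) σ₁ σ₃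
  | loop_zero {x P σ} : σ x = 0 → Exec (.loop x P) σ σ
  | loop_pos {x P σ₁ σ₂ σ₃} : 0 < σ₁ x → Exec P (update σ₁ x (σ₁ x - 1)) σ₂ →
      Exec (.loop x P) σ₂ σ₃ → Exec (.loop x P) σ₁ σ₃

namespace Prog

/-- The number of locations that the compiled program uses besides its exit. -/
def size : Prog → ℕ
  | skip => 0
  | inc _ => 1
  | seq P Q => P.size + Q.size
  | loop _ P => P.size + 2

/-- Compilation of a program to the edges of a counter machine whose locations start at the entry
`a` and end at the exit `a + P.size`. -/
def compile : Prog → ℕ → List Edge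
  | skip, _ => []
  | inc x, a => [(a, .inc x, a + 1)]
  | seq P Q, a => P.compile a ++ Q.compile (a + P.size)
  | loop x P, a => (a, .dec x, a + 1) :: (a, .zero x, a + (P.size + 2)) ::
      (a + 1 + P.size, .nop, a) :: P.compile (a + 1)

theorem compile_bounds {P : Prog} {a : ℕ} {e : Edge} (he : e ∈ P.compile a) :
    a ≤ e.1 ∧ e.1 < a + P.size ∧ a ≤ e.2.2 ∧ e.2.2 ≤ a + P.size := by
  induction P generalizing a with
  | skip => simp [compile] at he
  | inc x => simp [compile] at he; subst he; simp [size]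
  | seq P Q ihP ihQ =>
    simp only [compile, List.mem_append] at he
    simp only [size]
    rcases he with h | h
    · have := ihP h; omega
    · have := ihQ h; omega
  | loop x P ih =>
    simp only [compile, List.mem_cons] at he
    simp only [size]
    rcases he with h | h | h | h
    · subst h; dsimp only; omega
    · subst h; dsimp only; omega
    · subst h; dsimp only; omega
    · have := ih h; omega

/-- Two edges with the same source are equal, or they are the two branches of a loop, which exclude
each other. -/
theorem compile_edges_eq {P : Prog} {a s t t' : ℕ} {op op' : Op}
    (h : (s, op, t) ∈ P.compile a) (h' : (s, op', t') ∈ P.compile a) :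
    (op = op' ∧ t = t') ∨ (∃ x, op = .dec x ∧ op' = .zero x) ∨
      ∃ x, op = .zero x ∧ op' = .dec x := by
  induction P generalizing a with
  | skip => simp [compile] at h
  | inc x =>
    simp only [compile, List.mem_singleton, Prod.mk.injEq] at h h'
    left; simp_all
  | seq P Q ihP ihQ =>
    simp only [compile, List.mem_append] at h h'
    rcases h with h | h <;> rcases h' with h' | h'
    · exact ihP h h'
    · have := compile_bounds h; have := compile_bounds h'; dsimp only at *; omega
    · have := compile_bounds h; have := compile_bounds h'; dsimp only at *; omega
    · exact ihQ h h'
  | loop x P ih =>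
    simp only [compile, List.mem_cons, Prod.mk.injEq] at h h'
    by_cases hin : (s, op, t) ∈ P.compile (a + 1)
    · have hb := compile_bounds hin
      dsimp only at hb
      rcases h' with h' | h' | h' | h'
      · omega
      · omega
      · omega
      · exact ih hin h'
    · by_cases hin' : (s, op', t') ∈ P.compile (a + 1)
      · have hb := compile_bounds hin'
        dsimp only at hb
        rcases h with h | h | h | h
        · omega
        · omega
        · omega
        · exact absurd h hin
      · simp only [hin, hin', or_false] at h h'
        rcases h with ⟨h1, rfl, h3⟩ | ⟨h1, rfl, h3⟩ | ⟨h1, rfl, h3⟩ <;>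
          rcases h' with ⟨h1', rfl, h3'⟩ | ⟨h1', rfl, h3'⟩ | ⟨h1', rfl, h3'⟩ <;>
          first
          | (left; exact ⟨rfl, by omega⟩)
          | (right; left; exact ⟨x, rfl, rfl⟩)
          | (right; right; exact ⟨x, rfl, rfl⟩)
          | omega

/-- Compiled programs are deterministic. -/
theorem step_compile_rightUnique (P : Prog) (a : ℕ) : Relator.RightUnique (Step (P.compile a)) := by
  rintro ⟨s, σ⟩ ⟨t, τ⟩ ⟨t', τ'⟩ ⟨op, h, he⟩ ⟨op', h', he'⟩
  dsimp only at *
  rcases compile_edges_eq h h' with ⟨rfl, rfl⟩ | ⟨x, rfl, rfl⟩ | ⟨x, rfl, rfl⟩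
  · cases op <;> simp only [Op.Exec] at he he' <;> grind
  · simp only [Op.Exec] at he he'; omega
  · simp only [Op.Exec] at he he'; omega

end Prog

theorem Exec.reaches {P : Prog} {σ σ' : ℕ → ℕ} (h : Exec P σ σ') {a : ℕ} {E : List Edge}
    (hE : P.compile a ⊆ E) : Reaches E (a, σ) (a + P.size, σ') := by
  induction h generalizing a with
  | skip σ => exact .refl
  | inc x σ => exact .single ⟨.inc x, hE (by simp [Prog.compile, Prog.size]), rfl⟩
  | @seq P Q σ₁ σ₂ σ₃ _ _ ih₁ ih₂ =>
    simp only [Prog.compile, List.append_subset] at hE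
    have := (ih₁ hE.1).trans (ih₂ hE.2)
    rwa [Nat.add_assoc] at this
  | @loop_zero x P σ h0 =>
    exact .single ⟨.zero x, hE (by simp [Prog.compile, Prog.size]), h0, rfl⟩
  | @loop_pos x P σ₁ σ₂ σ₃ h0 _ _ ih₁ ih₂ =>
    have hE' := hE
    simp only [Prog.compile, List.cons_subset] at hE
    have s₁ : Step E (a, σ₁) (a + 1, update σ₁ x (σ₁ x - 1)) := ⟨.dec x, hE.1, h0, rfl⟩
    have s₂ : Step E (a + 1 + P.size, σ₂) (a, σ₂) := ⟨.nop, hE.2.2.1, rfl⟩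
    exact .head s₁ ((ih₁ hE.2.2.2).trans (.head s₂ (ih₂ hE')))

/-- A compiled program that reaches its exit does so with the store given by the big-step
semantics: the machine is deterministic and the exit has no outgoing edge. -/
theorem Exec.eq_of_reaches {P : Prog} {σ σ' τ : ℕ → ℕ} (h : Exec P σ σ') {a : ℕ}
    (hr : Reaches (P.compile a) (a, σ) (a + P.size, τ)) : τ = σ' := by
  have hstuck : ∀ ρ d, ¬ Step (P.compile a) (a + P.size, ρ) d := by
    rintro ρ d ⟨op, he, -⟩
    have := Prog.compile_bounds he
    dsimp only at this
    omega
  have key : ∀ ρ d, Reaches (P.compile a) (a + P.size, ρ) d → d = (a + P.size, ρ) := by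
    intro ρ d hd
    rcases ReflTransGen.cases_head hd with h | ⟨c, hc, -⟩
    · exact h.symm
    · exact absurd hc (hstuck _ _)
  rcases ReflTransGen.total_of_right_unique (Prog.step_compile_rightUnique P a) hr
    (h.reaches (List.Subset.refl _)) with h | h
  · exact (congrArg Prod.snd (key _ _ h)).symm
  · exact congrArg Prod.snd (key _ _ h)

/-! ### Primitive recursive functions are computed by while programs -/

theorem Exec.of_eq {P : Prog} {σ τ τ' : ℕ → ℕ} (h : Exec P σ τ) (e : τ = τ') : Exec P σ τ' :=
  e ▸ h

theorem exec_clear (x : ℕ) (σ : ℕ → ℕ) : Exec (.loop x .skip) σ (update σ x 0) := by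
  induction hn : σ x generalizing σ with
  | zero => exact (Exec.loop_zero hn).of_eq (by grind)
  | succ n ih =>
    refine .loop_pos (by omega) (.skip _) ((ih _ (by simp [hn])).of_eq (by simp))

theorem exec_move {x y : ℕ} (hxy : x ≠ y) (σ : ℕ → ℕ) :
    Exec (.loop x (.inc y)) σ (update (update σ x 0) y (σ y + σ x)) := by
  induction hn : σ x generalizing σ with
  | zero => exact (Exec.loop_zero hn).of_eq (by grind)
  | succ n ih =>
    refine .loop_pos (by omega) (.inc _ _) ((ih _ (by grind)).of_eq ?_)
    grind

/-- Adds the register `x` to the registers `y` and `t`, and clears `x`. -/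
theorem exec_move₂ {x y t : ℕ} (hxy : x ≠ y) (hxt : x ≠ t) (hyt : y ≠ t) (σ : ℕ → ℕ) :
    Exec (.loop x (.seq (.inc y) (.inc t))) σ
      (update (update (update σ x 0) y (σ y + σ x)) t (σ t + σ x)) := by
  induction hn : σ x generalizing σ with
  | zero => exact (Exec.loop_zero hn).of_eq (by grind)
  | succ n ih =>
    refine .loop_pos (by omega) (.seq (.inc _ _) (.inc _ _)) ((ih _ (by grind)).of_eq ?_)
    grind

/-- Adds the register `x` to the register `y`, with the help of the register `t`. -/
def copyProg (x y t : ℕ) : Prog :=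
  .seq (.loop x (.seq (.inc y) (.inc t))) (.loop t (.inc x))

theorem exec_copyProg {x y t : ℕ} (hxy : x ≠ y) (hxt : x ≠ t) (hyt : y ≠ t) {σ : ℕ → ℕ}
    (ht : σ t = 0) : Exec (copyProg x y t) σ (update σ y (σ y + σ x)) :=
  .seq (exec_move₂ hxy hxt hyt σ) ((exec_move hxt.symm _).of_eq (by grind))

theorem exists_clearProg (b n : ℕ) : ∃ P, ∀ σ : ℕ → ℕ,
    Exec P σ fun y => if b ≤ y ∧ y < b + n then 0 else σ y := by
  induction n with
  | zero => exact ⟨.skip, fun σ => (Exec.skip σ).of_eq (by grind)⟩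
  | succ n ih =>
    obtain ⟨P, hP⟩ := ih
    exact ⟨.seq P (.loop (b + n) .skip), fun σ =>
      .seq (hP σ) ((exec_clear (b + n) _).of_eq (by grind))⟩

/-- The function `f` is computed by a while program that reads its arguments in the registers `ins`,
adds the result to the empty register `o`, and uses the registers from `b` on as scratch space, empty
before and after the computation. The other registers keep their values. -/
def Computes {n : ℕ} (f : List.Vector ℕ n → ℕ) (ins : Fin n → ℕ) (o b : ℕ) : Prop :=
  ∃ P : Prog, ∀ σ : ℕ → ℕ, (∀ y, b ≤ y → σ y = 0) → σ o = 0 →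
    Exec P σ (update σ o (f (List.Vector.ofFn fun i => σ (ins i))))

/-- For a composition, the intermediate results are kept in the registers `b`, …, `b + n - 1`. -/
theorem computes_comp {m n : ℕ} {f : List.Vector ℕ n → ℕ} {g : Fin n → List.Vector ℕ m → ℕ}
    {ins : Fin m → ℕ} {o b : ℕ} (hins : ∀ i, ins i < b) (ho : o < b)
    (hf : Computes f (fun i => b + i) o (b + n))
    (hg : ∀ i : Fin n, Computes (g i) ins (b + i) (b + n)) :
    Computes (fun v => f (List.Vector.ofFn fun i => g i v)) ins o b := by
  obtain ⟨Pf, hPf⟩ := hf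
  choose Pg hPg using hg
  let G : (ℕ → ℕ) → ℕ → ℕ := fun σ y =>
    if h : y < n then g ⟨y, h⟩ (List.Vector.ofFn fun i => σ (ins i)) else 0
  have hargs : ∀ j ≤ n, ∃ P : Prog, ∀ σ : ℕ → ℕ, (∀ y, b ≤ y → σ y = 0) →
      Exec P σ fun y => if b ≤ y ∧ y < b + j then G σ (y - b) else σ y := by
    intro j
    induction j with
    | zero => exact fun _ => ⟨.skip, fun σ _ => (Exec.skip σ).of_eq (by grind)⟩
    | succ j ih =>
      intro hj
      obtain ⟨P, hP⟩ := ih (by omega)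
      refine ⟨.seq P (Pg ⟨j, hj⟩), fun σ hσ => .seq (hP σ hσ) ((hPg ⟨j, hj⟩ _ ?_ ?_).of_eq ?_)⟩
      · intro y hy
        rw [if_neg (by omega)]
        exact hσ y (by omega)
      · dsimp only
        rw [if_neg (by omega)]
        exact hσ _ (by omega)
      · have hv : (fun i => if b ≤ ins i ∧ ins i < b + j then G σ (ins i - b) else σ (ins i)) =
            fun i => σ (ins i) := by
          funext i
          rw [if_neg (by have := hins i; omega)]
        funext y
        rw [update_apply]
        dsimp only
        rw [hv]
        by_cases hy : y = b + j
        · subst hy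
          have : b + j - b = j := by omega
          rw [if_pos rfl, if_pos (by omega), this]
          simp only [G, dif_pos (show j < n from hj)]
        · rw [if_neg hy]
          by_cases hy' : b ≤ y ∧ y < b + j
          · rw [if_pos hy', if_pos (by omega)]
          · rw [if_neg hy', if_neg (by omega)]
  obtain ⟨P, hP⟩ := hargs n le_rfl
  obtain ⟨Pc, hPc⟩ := exists_clearProg b n
  refine ⟨.seq P (.seq Pf Pc), fun σ hσ hσo => .seq (hP σ hσ) (.seq (hPf _ ?_ ?_)
    ((hPc _).of_eq ?_))⟩
  · intro y hy
    rw [if_neg (by omega)]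
    exact hσ y (by omega)
  · rw [if_neg (by omega)]
    exact hσo
  · have hv : (fun i : Fin n => if b ≤ b + (i : ℕ) ∧ b + (i : ℕ) < b + n then G σ (b + i - b)
        else σ (b + i)) = fun i => g i (List.Vector.ofFn fun i => σ (ins i)) := by
      funext i
      have : b + (i : ℕ) - b = i := by omega
      rw [if_pos (by omega), this]
      exact dif_pos i.2
    funext y
    rw [hv]
    grind

theorem computes_prec {n : ℕ} {f : List.Vector ℕ n → ℕ} {g : List.Vector ℕ (n + 2) → ℕ}
    {ins : Fin (n + 1) → ℕ} {o b : ℕ} (hins : ∀ i, ins i < b) (hins' : ∀ i, ins i ≠ o) (ho : o < b)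
    (hf : Computes f (fun i => ins i.succ) o (b + 3))
    (hg : Computes g (Fin.cons (b + 1) (Fin.cons o fun i => ins i.succ)) (b + 2) (b + 3)) :
    Computes (fun v : List.Vector ℕ (n + 1) =>
      v.head.rec (f v.tail) fun y IH => g (y ::ᵥ IH ::ᵥ v.tail)) ins o b := by
  obtain ⟨Pf, hPf⟩ := hf
  obtain ⟨Pg, hPg⟩ := hg
  -- The register `b` counts the remaining iterations, `b + 1` those done; `o` accumulates.
  refine ⟨.seq (copyProg (ins 0) b (b + 1)) (.seq Pf (.seq
    (.loop b (.seq Pg (.seq (.loop o .skip) (.seq (.loop (b + 2) (.inc o)) (.inc (b + 1))))))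
    (.loop (b + 1) .skip))), fun σ hσ hσo => ?_⟩
  set v : List.Vector ℕ n := List.Vector.ofFn fun i => σ (ins i.succ) with hv
  have hofFn : (List.Vector.ofFn fun i => σ (ins i)) = σ (ins 0) ::ᵥ v := rfl
  rw [hofFn]
  simp only [List.Vector.head_cons, List.Vector.tail_cons]
  let F : ℕ → ℕ := fun j => Nat.rec (f v) (fun y IH => g (y ::ᵥ IH ::ᵥ v)) j
  let τ : ℕ → ℕ → ℕ → ℕ := fun k j => update (update (update σ b k) (b + 1) j) o (F j)
  have hi : ∀ i, ins i ≠ b ∧ ins i ≠ b + 1 ∧ ins i ≠ o := fun i => by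
    have := hins i; have := hins' i; omega
  have hbody : ∀ k j, Exec (.seq Pg (.seq (.loop o .skip) (.seq (.loop (b + 2) (.inc o))
      (.inc (b + 1))))) (τ k j) (τ k (j + 1)) := by
    intro k j
    have h1 : Exec Pg (τ k j) (update (τ k j) (b + 2) (F (j + 1))) := by
      refine (hPg (τ k j) (fun y hy => ?_) ?_).of_eq ?_
      · have := hσ y (by omega)
        grind
      · have := hσ (b + 2) (by omega)
        grind
      · have e1 : τ k j (b + 1) = j := by grind
        have e2 : τ k j o = F j := by grind
        have e3 : (fun i : Fin n => τ k j (ins i.succ)) = fun i => σ (ins i.succ) := by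
          funext i
          have := hi i.succ
          grind
        have : (List.Vector.ofFn fun i : Fin (n + 2) => τ k j
            ((Fin.cons (b + 1) (Fin.cons o fun i => ins i.succ) : Fin (n + 2) → ℕ) i)) =
            j ::ᵥ F j ::ᵥ v := by
          change τ k j (b + 1) ::ᵥ τ k j o ::ᵥ (List.Vector.ofFn fun i => τ k j (ins i.succ)) = _
          rw [e1, e2, e3]
        rw [this]
    refine .seq h1 (.seq (exec_clear o _) (.seq (exec_move (by omega) _)
      ((Exec.inc (b + 1) _).of_eq ?_)))
    have := hσ (b + 2) (by omega)
    funext y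
    simp only [τ, update_apply]
    grind
  have hloop : ∀ k j, Exec (.loop b (.seq Pg (.seq (.loop o .skip) (.seq (.loop (b + 2) (.inc o))
      (.inc (b + 1)))))) (τ k j) (τ 0 (j + k)) := by
    intro k
    induction k with
    | zero => exact fun j => .loop_zero (by grind)
    | succ k ih =>
      intro j
      have e1 : τ (k + 1) j b = k + 1 := by grind
      have e2 : update (τ (k + 1) j) b (τ (k + 1) j b - 1) = τ k j := by
        rw [e1]
        funext y
        simp only [τ, update_apply]
        grind
      refine .loop_pos (by omega) (e2 ▸ hbody k j) ((ih (j + 1)).of_eq ?_)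
      rw [Nat.add_right_comm, Nat.add_assoc]
  refine .seq (exec_copyProg (hi 0).1 (hi 0).2.1 (by omega) (hσ _ (by omega)))
    (.seq (σ₂ := τ (σ (ins 0)) 0) ((hPf _ (fun y hy => ?_) ?_).of_eq ?_) (.seq (hloop _ _)
      ((exec_clear _ _).of_eq ?_)))
  · have := hσ y (by omega)
    grind
  · grind
  · have e3 : (fun i : Fin n => update σ b (σ b + σ (ins 0)) (ins i.succ)) =
        fun i => σ (ins i.succ) := by
      funext i
      have := hi i.succ
      grind
    rw [e3, ← hv]
    have h0 := hσ b le_rfl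
    have h1 := hσ (b + 1) (by omega)
    have h2 : F 0 = f v := rfl
    funext y
    simp only [τ, update_apply]
    grind
  · have h0 := hσ b le_rfl
    have h1 := hσ (b + 1) (by omega)
    funext y
    simp only [τ, update_apply, Nat.zero_add, F]
    grind

theorem computes_of_primrec' {n : ℕ} {f : List.Vector ℕ n → ℕ} (hf : Nat.Primrec' f)
    {ins : Fin n → ℕ} {o b : ℕ} (hins : ∀ i, ins i < b) (hins' : ∀ i, ins i ≠ o) (ho : o < b) :
    Computes f ins o b := by
  induction hf generalizing o b with
  | zero => exact ⟨.skip, fun σ _ h => (Exec.skip σ).of_eq (by grind)⟩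
  | succ =>
    have := hins 0
    refine ⟨.seq (copyProg (ins 0) o b) (.inc o), fun σ h h' => .seq (exec_copyProg (hins' 0)
      (by omega) (by omega) (h _ le_rfl)) ((Exec.inc _ _).of_eq ?_)⟩
    have e : (List.Vector.ofFn fun i => σ (ins i)).head = σ (ins 0) := rfl
    dsimp only
    rw [e]
    grind
  | get i =>
    have := hins i
    refine ⟨copyProg (ins i) o b, fun σ h h' => (exec_copyProg (hins' i)
      (by omega) (by omega) (h _ le_rfl)).of_eq ?_⟩
    dsimp only
    rw [List.Vector.get_ofFn, h', Nat.zero_add]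
  | @comp m n f g _ _ ihf ihg =>
    refine computes_comp hins ho (ihf (fun i => by omega) (fun i => by omega) (by omega))
      fun i => ihg i (fun j => ?_) (fun j => ?_) (by omega)
    · have := hins j; omega
    · have := hins j; omega
  | prec _ _ ihf ihg =>
    refine computes_prec hins hins' ho (ihf (fun i => ?_) (fun i => hins' _) (by omega))
      (ihg (fun i => ?_) (fun i => ?_) (by omega))
    · have := hins i.succ; omega
    · refine Fin.cases ?_ (fun i => Fin.cases ?_ (fun i => ?_) i) i
      · simp
      · simp; omega
      · have := hins i.succ; simp; omega
    · refine Fin.cases ?_ (fun i => Fin.cases ?_ (fun i => ?_) i) i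
      · simp
      · simp; omega
      · have := hins i.succ; simp; omega

/-! ### A counter machine searching for a zero of a computable function -/

/-- The edges `a → a + 1 → ⋯ → a + m` that increment the register `0`. -/
def chain (a m : ℕ) : List Edge := (List.range m).map fun j => (a + j, .inc 0, a + j + 1)

/-- The part of `searchMachine` that does not depend on `m`: the location `0`, at which the register
`1` is given an arbitrary value, the program `P` from the location `2` on, and the test that takes its
exit to the location `1` if the register `2` is empty. -/
def searchCore (P : Prog) : List Edge :=
  (0, .inc 1, 0) :: (0, .nop, 2) :: (2 + P.size, .zero 2, 1) :: P.compile 2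

/-- The counter machine that sets the register `0` to `m`, guesses a value for the register `1`, runs
`P`, and then reaches the location `1` if the register `2` is empty. It starts at the location
`P.size + 3`. -/
def searchMachine (P : Prog) (m : ℕ) : List Edge :=
  searchCore P ++ (chain (P.size + 3) m ++ [(P.size + 3 + m, .nop, 0)])

/-- The store with the value `i` in the register `0` and `k` in the register `1`. -/
def inputStore (i k : ℕ) : ℕ → ℕ := update (update (fun _ => 0) 0 i) 1 k

theorem inputStore_inc_zero (i : ℕ) :
    update (inputStore i 0) 0 (inputStore i 0 0 + 1) = inputStore (i + 1) 0 := by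
  simp only [inputStore]
  grind

theorem inputStore_inc_one (i k : ℕ) :
    update (inputStore i k) 1 (inputStore i k 1 + 1) = inputStore i (k + 1) := by
  simp only [inputStore]
  grind

theorem inputStore_zero_zero : inputStore 0 0 = fun _ => 0 := by
  simp only [inputStore]
  grind

/-- Completeness of the search: a zero of `f m` gives a run that reaches the location `1`. -/
theorem searchMachine_reaches {P : Prog} {f : ℕ → ℕ → ℕ}
    (hP : ∀ m k, Exec P (inputStore m k) (update (inputStore m k) 2 (f m k)))
    {m k : ℕ} (h : f m k = 0) : ∃ σ,
    Reaches (searchMachine P m) (P.size + 3, fun _ => 0) (1, σ) := by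
  set E := searchMachine P m with hE
  have hchain : ∀ j ≤ m, Reaches E (P.size + 3, fun _ => 0) (P.size + 3 + j, inputStore j 0) := by
    intro j
    induction j with
    | zero => intro _; rw [inputStore_zero_zero]
    | succ j ih =>
      intro hj
      refine (ih (by omega)).tail ⟨.inc 0, ?_, (inputStore_inc_zero j).symm⟩
      simp only [hE, searchMachine, chain, List.mem_append, List.mem_map, List.mem_range]
      exact .inr (.inl ⟨j, by omega, rfl⟩)
  have hguess : ∀ i, Reaches E (0, inputStore m 0) (0, inputStore m i) := by
    intro i
    induction i with
    | zero => exact .refl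
    | succ i ih =>
      exact ih.tail ⟨.inc 1, by simp [hE, searchMachine, searchCore],
        (inputStore_inc_one m i).symm⟩
  refine ⟨update (inputStore m k) 2 (f m k), ?_⟩
  have hnop : Reaches E (P.size + 3 + m, inputStore m 0) (0, inputStore m 0) :=
    .single ⟨.nop, by simp [hE, searchMachine], rfl⟩
  have hprog : Reaches E (0, inputStore m k) (2 + P.size, update (inputStore m k) 2 (f m k)) :=
    .head (b := (2, inputStore m k)) ⟨.nop, by simp [hE, searchMachine, searchCore], rfl⟩
      ((hP m k).reaches fun e he => by simp [hE, searchMachine, searchCore, he])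
  exact ((((hchain m le_rfl).trans hnop).trans (hguess k)).trans hprog).tail
    ⟨.zero 2, by simp [hE, searchMachine, searchCore], by simp [h], rfl⟩

/-- Soundness of the search: a run that reaches the location `1` has guessed a zero of `f m`. -/
theorem exists_eq_zero_of_searchMachine_reaches {P : Prog} {f : ℕ → ℕ → ℕ}
    (hP : ∀ m k, Exec P (inputStore m k) (update (inputStore m k) 2 (f m k)))
    {m : ℕ} {σ : ℕ → ℕ}
    (h : Reaches (searchMachine P m) (P.size + 3, fun _ => 0) (1, σ)) : ∃ k, f m k = 0 := by
  suffices hinv : ∀ c, Reaches (searchMachine P m) (P.size + 3, fun _ => 0) c →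
      (∃ j, c.1 = P.size + 3 + j ∧ c.2 = inputStore j 0) ∨
      (c.1 = 0 ∧ ∃ k, c.2 = inputStore m k) ∨
      (2 ≤ c.1 ∧ c.1 ≤ 2 + P.size ∧ ∃ k, Reaches (P.compile 2) (2, inputStore m k) c) ∨
      (c.1 = 1 ∧ ∃ k, f m k = 0) by
    rcases hinv _ h with ⟨j, h1, -⟩ | ⟨h1, -⟩ | ⟨h1, -⟩ | ⟨-, h1⟩
    · dsimp only at h1; omega
    · exact absurd h1 one_ne_zero
    · exact absurd h1 (by simp)
    · exact h1
  intro c hc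
  induction hc with
  | refl => exact .inl ⟨0, rfl, inputStore_zero_zero.symm⟩
  | @tail c d _ hs ih =>
    obtain ⟨s, σ⟩ := c
    obtain ⟨t, τ⟩ := d
    obtain ⟨op, he, hop⟩ := hs
    simp only [searchMachine, searchCore, chain, List.cons_append, List.mem_cons, List.mem_append,
      List.mem_map, List.mem_range, Prod.mk.injEq, List.not_mem_nil, or_false] at he
    dsimp only at hop ih ⊢
    rcases he with ⟨hs, rfl, ht⟩ | ⟨hs, rfl, ht⟩ | ⟨hs, rfl, ht⟩ | he | ⟨i, hi, hs, rfl, ht⟩ |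
      ⟨hs, rfl, ht⟩
    · rcases ih with ⟨j, h1, -⟩ | ⟨-, k, h2⟩ | ⟨h1, -⟩ | ⟨h1, -⟩ <;> try omega
      subst h2
      exact .inr (.inl ⟨ht, k + 1, hop.trans (inputStore_inc_one m k)⟩)
    · rcases ih with ⟨j, h1, -⟩ | ⟨-, k, h2⟩ | ⟨h1, -⟩ | ⟨h1, -⟩ <;> try omega
      have hop : τ = σ := hop
      subst h2 hop ht
      exact .inr (.inr (.inl ⟨le_rfl, by omega, k, .refl⟩))
    · rcases ih with ⟨j, h1, -⟩ | ⟨h1, -⟩ | ⟨-, -, k, h2⟩ | ⟨h1, -⟩ <;> try omega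
      subst hs
      have := (hP m k).eq_of_reaches h2
      subst this
      refine .inr (.inr (.inr ⟨ht, k, ?_⟩))
      simpa using hop.1
    · have hb := Prog.compile_bounds he
      dsimp only at hb
      rcases ih with ⟨j, h1, -⟩ | ⟨h1, -⟩ | ⟨-, -, k, h2⟩ | ⟨h1, -⟩ <;> try omega
      exact .inr (.inr (.inl ⟨by omega, by omega, k, h2.tail ⟨op, he, hop⟩⟩))
    · rcases ih with ⟨j, h1, h2⟩ | ⟨h1, -⟩ | ⟨-, h1, -⟩ | ⟨h1, -⟩ <;> try omega
      obtain rfl : i = j := by omega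
      subst h2
      exact .inl ⟨i + 1, by omega, hop.trans (inputStore_inc_zero i)⟩
    · rcases ih with ⟨j, h1, h2⟩ | ⟨h1, -⟩ | ⟨-, h1, -⟩ | ⟨h1, -⟩ <;> try omega
      obtain rfl : m = j := by omega
      exact .inr (.inl ⟨ht.symm ▸ rfl, 0, hop.trans h2⟩)

end CounterMachine

/-! ### Steps of protocols -/

namespace Protocol

open Relation

theorem pair_add {Q : Type} (a b : Q) (D : Multiset Q) :
    ({a, b} : Multiset Q) + D = a ::ₘ b ::ₘ D := by
  rw [Multiset.insert_eq_cons, Multiset.cons_add, Multiset.singleton_add]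

section Steps

variable {Q M : Type} [DecidableEq Q] {P : Protocol Q M} {C C' D : Multiset Q}
  {q q' q₁ q₁' q₂ q₂' : Q} {m : M}

theorem step_tau (ht : (q, .tau, q') ∈ P.T) : P.Step (q ::ₘ D) (q' ::ₘ D) := by
  have h : P.LabelledStep (q ::ₘ D) .tau (q ::ₘ D - {q} + {q'}) := .internal ht (by simp)
  rw [Multiset.sub_singleton, Multiset.erase_cons_head, add_comm, Multiset.singleton_add] at h
  exact ⟨_, h⟩

theorem step_rendezvous (hs : (q₁, .send m, q₁') ∈ P.T) (hr : (q₂, .recv m, q₂') ∈ P.T) :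
    P.Step (q₁ ::ₘ q₂ ::ₘ D) (q₁' ::ₘ q₂' ::ₘ D) := by
  have h : P.LabelledStep (D + {q₁, q₂}) (.rdv m) (D + {q₁, q₂} - {q₁, q₂} + {q₁', q₂'}) :=
    .rendezvous hs hr (Multiset.le_add_left _ _)
  rw [add_tsub_cancel_right] at h
  rw [← pair_add, ← pair_add, add_comm, add_comm _ D]
  exact ⟨_, h⟩

theorem step_nonblocking (hs : (q₁, .send m, q₁') ∈ P.T)
    (hn : ∀ q₂ q₂', (q₂, .recv m, q₂') ∈ P.T → q₂ ∉ D) : P.Step (q₁ ::ₘ D) (q₁' ::ₘ D) := by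
  have h : P.LabelledStep (q₁ ::ₘ D) (.nb m) (q₁ ::ₘ D - {q₁} + {q₁'}) :=
    .nonblocking hs (by simp) (by simpa using hn)
  rw [Multiset.sub_singleton, Multiset.erase_cons_head, add_comm, Multiset.singleton_add] at h
  exact ⟨_, h⟩

/-- The three kinds of steps, without subtraction of multisets. -/
theorem step_cases (h : P.Step C C') :
    (∃ q q' D, (q, .tau, q') ∈ P.T ∧ C = q ::ₘ D ∧ C' = q' ::ₘ D) ∨
    (∃ m q₁ q₁' q₂ q₂' D, (q₁, .send m, q₁') ∈ P.T ∧ (q₂, .recv m, q₂') ∈ P.T ∧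
      C = q₁ ::ₘ q₂ ::ₘ D ∧ C' = q₁' ::ₘ q₂' ::ₘ D) ∨
    ∃ m q₁ q₁' D, (q₁, .send m, q₁') ∈ P.T ∧ (∀ q₂ q₂', (q₂, .recv m, q₂') ∈ P.T → q₂ ∉ D) ∧
      C = q₁ ::ₘ D ∧ C' = q₁' ::ₘ D := by
  obtain ⟨a, h⟩ := h
  cases h with
  | @internal q q' ht hq =>
    refine .inl ⟨q, q', C - {q}, ht, ?_, ?_⟩
    · rw [Multiset.sub_singleton, Multiset.cons_erase (Multiset.count_pos.1 hq)]
    · rw [add_comm, Multiset.singleton_add]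
  | @rendezvous m q₁ q₁' q₂ q₂' hs hr hC =>
    refine .inr (.inl ⟨m, q₁, q₁', q₂, q₂', C - {q₁, q₂}, hs, hr, ?_, ?_⟩)
    · rw [← pair_add, add_tsub_cancel_of_le hC]
    · rw [← pair_add, add_comm]
  | @nonblocking m q₁ q₁' hs hq hn =>
    refine .inr (.inr ⟨m, q₁, q₁', C - {q₁}, hs, fun q₂ q₂' h => ?_, ?_, ?_⟩)
    · exact Multiset.count_eq_zero.1 (hn q₂ q₂' h)
    · rw [Multiset.sub_singleton, Multiset.cons_erase (Multiset.count_pos.1 hq)]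
    · rw [add_comm, Multiset.singleton_add]

theorem isInitial_iff : P.IsInitial C ↔ C ≠ 0 ∧ ∀ q ∈ C, q = P.qin := by
  simp only [IsInitial, Multiset.count_eq_zero, not_imp_not, ne_eq]

theorem isAllFinal_iff : P.IsAllFinal C ↔ C ≠ 0 ∧ ∀ q ∈ C, q = P.qf := by
  simp only [IsAllFinal, Multiset.count_eq_zero, not_imp_not, ne_eq]

end Steps

/-! ### Renaming states and messages -/

variable {Q M Q' M' : Type}

/-- Renaming the message of a primitive. -/
def _root_.Primitive.map (μ : M → M') : Primitive M → Primitive M'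
  | .tau => .tau
  | .send m => .send (μ m)
  | .recv m => .recv (μ m)

/-- `P'` is `P` with its states renamed by `e` and its messages renamed by `μ`. States and messages
of `P'` that are not new names occur in no transition. -/
structure IsRenaming (P : Protocol Q M) (P' : Protocol Q' M') (e : Q → Q') (μ : M → M') : Prop where
  state_injective : Function.Injective e
  message_injective : Function.Injective μ
  qin_eq : P'.qin = e P.qin
  qf_eq : P'.qf = e P.qf
  mem_T_iff : ∀ t, t ∈ P'.T ↔ ∃ u ∈ P.T, (e u.1, u.2.1.map μ, e u.2.2) = t

namespace IsRenaming

variable {P : Protocol Q M} {P' : Protocol Q' M'} {e : Q → Q'} {μ : M → M'}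

theorem mem_tau (h : IsRenaming P P' e μ) {q q' : Q'} (ht : (q, .tau, q') ∈ P'.T) :
    ∃ r r', (r, .tau, r') ∈ P.T ∧ e r = q ∧ e r' = q' := by
  obtain ⟨⟨r, p, r'⟩, hu, hp⟩ := (h.mem_T_iff _).1 ht
  cases p <;> simp only [Primitive.map, Prod.mk.injEq, reduceCtorEq, false_and, and_false] at hp
  exact ⟨r, r', hu, hp.1, hp.2.2⟩

theorem mem_send (h : IsRenaming P P' e μ) {q q' : Q'} {m : M'} (ht : (q, .send m, q') ∈ P'.T) :
    ∃ r k r', (r, .send k, r') ∈ P.T ∧ e r = q ∧ μ k = m ∧ e r' = q' := by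
  obtain ⟨⟨r, p, r'⟩, hu, hp⟩ := (h.mem_T_iff _).1 ht
  cases p <;> simp only [Primitive.map, Prod.mk.injEq, reduceCtorEq, false_and, and_false,
    Primitive.send.injEq] at hp
  exact ⟨r, _, r', hu, hp⟩

theorem mem_recv (h : IsRenaming P P' e μ) {q q' : Q'} {m : M'} (ht : (q, .recv m, q') ∈ P'.T) :
    ∃ r k r', (r, .recv k, r') ∈ P.T ∧ e r = q ∧ μ k = m ∧ e r' = q' := by
  obtain ⟨⟨r, p, r'⟩, hu, hp⟩ := (h.mem_T_iff _).1 ht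
  cases p <;> simp only [Primitive.map, Prod.mk.injEq, reduceCtorEq, false_and, and_false,
    Primitive.recv.injEq] at hp
  exact ⟨r, _, r', hu, hp⟩

theorem step_map [DecidableEq Q] [DecidableEq Q'] (h : IsRenaming P P' e μ) {C C' : Multiset Q}
    (hst : P.Step C C') : P'.Step (C.map e) (C'.map e) := by
  have hT : ∀ {q p q'}, (q, p, q') ∈ P.T → (e q, p.map μ, e q') ∈ P'.T :=
    fun ht => (h.mem_T_iff _).2 ⟨_, ht, rfl⟩
  rcases step_cases hst with ⟨q, q', D, ht, rfl, rfl⟩ |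
    ⟨m, q₁, q₁', q₂, q₂', D, hs, hr, rfl, rfl⟩ | ⟨m, q₁, q₁', D, hs, hn, rfl, rfl⟩
  · simp only [Multiset.map_cons]
    exact step_tau (hT ht)
  · simp only [Multiset.map_cons]
    exact step_rendezvous (hT hs) (hT hr)
  · simp only [Multiset.map_cons]
    refine step_nonblocking (hT hs) fun q₂ q₂' hr hq => ?_
    obtain ⟨r, k, r', hr', rfl, hk, rfl⟩ := h.mem_recv hr
    obtain rfl := h.message_injective hk
    rw [Multiset.mem_map_of_injective h.state_injective] at hq
    exact hn _ _ hr' hq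

theorem exists_of_map_eq_cons (h : IsRenaming P P' e μ) {C : Multiset Q} {r : Q} {D : Multiset Q'}
    (hC : C.map e = e r ::ₘ D) : ∃ C₀, C = r ::ₘ C₀ ∧ D = C₀.map e := by
  classical
  obtain ⟨a, ha, har, hD⟩ := (Multiset.map_eq_cons e C D (e r)).2 hC
  obtain rfl := h.state_injective har
  exact ⟨C.erase a, (Multiset.cons_erase ha).symm, hD.symm⟩

theorem exists_step_of_step_map [DecidableEq Q] [DecidableEq Q'] (h : IsRenaming P P' e μ)
    {C : Multiset Q} {D : Multiset Q'}
    (hst : P'.Step (C.map e) D) : ∃ C', P.Step C C' ∧ D = C'.map e := by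
  rcases step_cases hst with ⟨q, q', D, ht, hC, rfl⟩ |
    ⟨m, q₁, q₁', q₂, q₂', D, hs, hr, hC, rfl⟩ | ⟨m, q₁, q₁', D, hs, hn, hC, rfl⟩
  · obtain ⟨r, r', ht', rfl, rfl⟩ := h.mem_tau ht
    obtain ⟨C₀, rfl, rfl⟩ := h.exists_of_map_eq_cons hC
    exact ⟨r' ::ₘ C₀, step_tau ht', (Multiset.map_cons ..).symm⟩
  · obtain ⟨r₁, k, r₁', hs', rfl, rfl, rfl⟩ := h.mem_send hs
    obtain ⟨r₂, k', r₂', hr', rfl, hk, rfl⟩ := h.mem_recv hr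
    obtain rfl := h.message_injective hk
    obtain ⟨C₀, rfl, hC'⟩ := h.exists_of_map_eq_cons hC
    obtain ⟨C₀, rfl, rfl⟩ := h.exists_of_map_eq_cons hC'.symm
    exact ⟨r₁' ::ₘ r₂' ::ₘ C₀, step_rendezvous hs' hr', by simp⟩
  · obtain ⟨r₁, k, r₁', hs', rfl, rfl, rfl⟩ := h.mem_send hs
    obtain ⟨C₀, rfl, rfl⟩ := h.exists_of_map_eq_cons hC
    refine ⟨r₁' ::ₘ C₀, step_nonblocking hs' fun q₂ q₂' hr hq => ?_, (Multiset.map_cons ..).symm⟩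
    exact hn (e q₂) (e q₂') ((h.mem_T_iff _).2 ⟨_, hr, rfl⟩) (Multiset.mem_map_of_mem e hq)

/-- Renaming does not change whether a protocol can synchronize. -/
theorem synchro_iff [DecidableEq Q] [DecidableEq Q'] (h : IsRenaming P P' e μ) :
    P'.Synchro ↔ P.Synchro := by
  constructor
  · rintro ⟨C₀, Cf, h₀, hf, hr⟩
    rw [isInitial_iff] at h₀
    rw [isAllFinal_iff] at hf
    have hmap : ∀ {D}, ReflTransGen P'.Step C₀ D → ∃ C,
        ReflTransGen P.Step (Multiset.replicate C₀.card P.qin) C ∧ D = C.map e := by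
      intro D hD
      induction hD with
      | refl =>
        refine ⟨_, .refl, ?_⟩
        rw [Multiset.map_replicate, ← h.qin_eq]
        exact Multiset.eq_replicate_card.2 h₀.2
      | tail _ hs ih =>
        obtain ⟨C, hC, rfl⟩ := ih
        obtain ⟨C', hC', rfl⟩ := h.exists_step_of_step_map hs
        exact ⟨C', hC.tail hC', rfl⟩
    obtain ⟨C, hC, rfl⟩ := hmap hr
    refine ⟨_, C, isInitial_iff.2 ⟨?_, ?_⟩, isAllFinal_iff.2 ⟨?_, ?_⟩, hC⟩
    · rw [ne_eq, ← Multiset.card_eq_zero, Multiset.card_replicate, Multiset.card_eq_zero]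
      exact h₀.1
    · exact fun q hq => Multiset.eq_of_mem_replicate hq
    · rintro rfl
      exact hf.1 rfl
    · exact fun q hq => h.state_injective ((hf.2 _ (Multiset.mem_map_of_mem e hq)).trans h.qf_eq)
  · rintro ⟨C₀, Cf, h₀, hf, hr⟩
    rw [isInitial_iff] at h₀
    rw [isAllFinal_iff] at hf
    refine ⟨C₀.map e, Cf.map e, isInitial_iff.2 ⟨by simpa using h₀.1, ?_⟩,
      isAllFinal_iff.2 ⟨by simpa using hf.1, ?_⟩,
      ReflTransGen.lift (Multiset.map e) (fun _ _ hst => h.step_map hst) _ _ hr⟩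
    · intro q hq
      obtain ⟨r, hr, rfl⟩ := Multiset.mem_map.1 hq
      rw [h₀.2 r hr, h.qin_eq]
    · intro q hq
      obtain ⟨r, hr, rfl⟩ := Multiset.mem_map.1 hq
      rw [hf.2 r hr, h.qf_eq]

theorem mem_T_of_mem (h : IsRenaming P P' e μ) {q q' : Q} {p : Primitive M}
    (ht : (q, p, q') ∈ P.T) : (e q, p.map μ, e q') ∈ P'.T :=
  (h.mem_T_iff _).2 ⟨_, ht, rfl⟩

theorem waitOnly_iff (h : IsRenaming P P' e μ) : P'.WaitOnly ↔ P.WaitOnly := by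
  constructor
  · rintro ⟨QA, QW, hU, hd, hi, hA, hW⟩
    refine ⟨e ⁻¹' QA, e ⁻¹' QW, ?_, hd.preimage e, by rwa [Set.mem_preimage, ← h.qin_eq],
      fun q hq m q' ht => hA _ hq _ _ (h.mem_T_of_mem ht),
      fun q hq => ⟨fun m q' ht => (hW _ hq).1 _ _ (h.mem_T_of_mem ht),
        fun q' ht => (hW _ hq).2 _ (h.mem_T_of_mem ht)⟩⟩
    rw [← Set.preimage_union, hU, Set.preimage_univ]
  · rintro ⟨QA, QW, hU, hd, hi, hA, hW⟩
    have hWq : ∀ q, e q ∉ e '' QA → q ∈ QW := fun q hq =>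
      ((Set.eq_univ_iff_forall.1 hU q).resolve_left fun hA => hq ⟨q, hA, rfl⟩)
    refine ⟨e '' QA, (e '' QA)ᶜ, Set.union_compl_self _, disjoint_compl_right,
      h.qin_eq ▸ ⟨_, hi, rfl⟩, ?_, fun q hq => ⟨fun m q' ht => ?_, fun q' ht => ?_⟩⟩
    · rintro _ ⟨q, hq, rfl⟩ m q' ht
      obtain ⟨r, k, r', hr, he, -, -⟩ := h.mem_recv ht
      obtain rfl := h.state_injective he
      exact hA _ hq _ _ hr
    · obtain ⟨r, k, r', hr, rfl, -, -⟩ := h.mem_send ht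
      exact (hW _ (hWq r hq)).1 _ _ hr
    · obtain ⟨r, r', hr, rfl, -⟩ := h.mem_tau ht
      exact (hW _ (hWq r hq)).2 _ hr

end IsRenaming

end Protocol

/-! ### The protocol that simulates a counter machine -/

namespace Simulation

open CounterMachine Function Relation

/-- The states of the simulating protocol. A process leaves `qin` as the leader (`lead`), who is at
the location `s` of the machine in the state `run s` and waits for an acknowledgement before getting
there in `wait s`, or as the warden of a leader (`warden`), or as a member of the pool (`pool`). The
value of the register `x` is the number of processes in `unit x`; `up x` and `down` are passed by a
process that joins or leaves `unit x`. -/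
inductive State : Type
  | qin : State
  | sink : State
  | qf : State
  | warden : State
  | lead : State
  | pool : State
  | down : State
  | up (x : ℕ) : State
  | unit (x : ℕ) : State
  | run (s : ℕ) : State
  | wait (s : ℕ) : State
  deriving DecidableEq

/-- The messages of the simulating protocol. -/
inductive Msg : Type
  | elect : Msg
  | warden : Msg
  | ack : Msg
  | release : Msg
  | inc (x : ℕ) : Msg
  | dec (x : ℕ) : Msg
  | zero (x : ℕ) : Msg

open State Primitive

/-- The transitions that simulate an edge of the machine. An increment or a decrement is requested
by the leader and acknowledged by the process that executes it, so that the leader is stuck if the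
request had no receiver. A zero test has no acknowledgement; a process in `unit x` that receives it is
lost in `sink`. -/
def edgeTransitions : Edge → List (State × Primitive Msg × State)
  | (s, .nop, t) => [(run s, tau, run t)]
  | (s, .inc x, t) => [(run s, send (.inc x), wait t), (wait t, recv .ack, run t),
      (pool, recv (.inc x), up x), (up x, send .ack, unit x), (unit x, recv .release, qf)]
  | (s, .dec x, t) => [(run s, send (.dec x), wait t), (wait t, recv .ack, run t),
      (unit x, recv (.dec x), down), (down, send .ack, pool)]
  | (s, .zero x, t) => [(run s, send (.zero x), run t), (unit x, recv (.zero x), sink)]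

/-- The transitions that serve to elect a leader with a warden, to fill the pool, and to release
everybody when the machine has reached the location `fin`. -/
def controlTransitions (start fin : ℕ) : List (State × Primitive Msg × State) :=
  [(qin, send .elect, lead), (qin, send .warden, warden), (qin, tau, pool),
    (lead, recv .warden, run start), (lead, recv .elect, sink), (warden, recv .elect, sink),
    (warden, recv .release, qf), (pool, recv .release, qf), (run fin, send .release, run fin),
    (run fin, tau, qf)]

/-- The protocol that simulates the counter machine with edges `E`, initial location `start` and
final location `fin`. -/
def simulator (E : List Edge) (start fin : ℕ) : Protocol State Msg where
  qin := qin
  qf := qf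
  T := {t | t ∈ E.flatMap edgeTransitions ++ controlTransitions start fin}

variable {E : List Edge} {start fin : ℕ}

theorem mem_T_iff {t : State × Primitive Msg × State} : t ∈ (simulator E start fin).T ↔
    (∃ e ∈ E, t ∈ edgeTransitions e) ∨ t ∈ controlTransitions start fin := by
  simp [simulator]

theorem mem_T_of_mem_edge {t : State × Primitive Msg × State} {e : Edge} (he : e ∈ E)
    (ht : t ∈ edgeTransitions e) : t ∈ (simulator E start fin).T :=
  mem_T_iff.2 (.inl ⟨e, he, ht⟩)

theorem mem_T_of_mem_control {t : State × Primitive Msg × State}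
    (ht : t ∈ controlTransitions start fin) : t ∈ (simulator E start fin).T :=
  mem_T_iff.2 (.inr ht)

theorem tau_cases {q q' : State} (h : (q, tau, q') ∈ (simulator E start fin).T) :
    (q = qin ∧ q' = pool) ∨ (∃ s t, (s, .nop, t) ∈ E ∧ q = run s ∧ q' = run t) ∨
      (q = run fin ∧ q' = qf) := by
  rcases mem_T_iff.1 h with ⟨⟨s, op, t⟩, he, h⟩ | h
  · cases op <;> simp [edgeTransitions] at h
    exact .inr (.inl ⟨s, t, he, h⟩)
  · simp [controlTransitions] at h
    tauto

theorem send_cases {q q' : State} {m : Msg} (h : (q, send m, q') ∈ (simulator E start fin).T) :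
    (q = qin ∧ m = .elect ∧ q' = lead) ∨ (q = qin ∧ m = .warden ∧ q' = warden) ∨
      (q = run fin ∧ m = .release ∧ q' = run fin) ∨
      (∃ s x t, (s, .inc x, t) ∈ E ∧ q = run s ∧ m = .inc x ∧ q' = wait t) ∨
      (∃ s x t, (s, .dec x, t) ∈ E ∧ q = run s ∧ m = .dec x ∧ q' = wait t) ∨
      (∃ s x t, (s, .zero x, t) ∈ E ∧ q = run s ∧ m = .zero x ∧ q' = run t) ∨
      (∃ x, q = up x ∧ m = .ack ∧ q' = unit x) ∨ (q = down ∧ m = .ack ∧ q' = pool) := by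
  rcases mem_T_iff.1 h with ⟨⟨s, op, t⟩, he, h⟩ | h
  · cases op <;> simp [edgeTransitions] at h
    · rcases h with h | ⟨rfl, rfl, rfl⟩
      · exact .inr (.inr (.inr (.inl ⟨_, _, _, he, h⟩)))
      · simp
    · rcases h with h | h
      · exact .inr (.inr (.inr (.inr (.inl ⟨_, _, _, he, h⟩))))
      · simp [h]
    · exact .inr (.inr (.inr (.inr (.inr (.inl ⟨_, _, _, he, h⟩)))))
  · simp [controlTransitions] at h
    tauto

theorem recv_cases {q q' : State} {m : Msg} (h : (q, recv m, q') ∈ (simulator E start fin).T) :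
    (q = lead ∧ m = .warden ∧ q' = run start) ∨ (q = lead ∧ m = .elect ∧ q' = sink) ∨
      (q = warden ∧ m = .elect ∧ q' = sink) ∨ (m = .release ∧ q' = qf) ∨
      (∃ t, q = wait t ∧ m = .ack ∧ q' = run t) ∨ (∃ x, q = pool ∧ m = .inc x ∧ q' = up x) ∨
      (∃ x, q = unit x ∧ m = .dec x ∧ q' = down) ∨ (∃ x, q = unit x ∧ m = .zero x ∧ q' = sink) := by
  rcases mem_T_iff.1 h with ⟨⟨s, op, t⟩, he, h⟩ | h
  · cases op <;> simp [edgeTransitions] at h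
    · rcases h with ⟨rfl, rfl, rfl⟩ | ⟨rfl, rfl, rfl⟩ | ⟨rfl, rfl, rfl⟩ <;> simp
    · rcases h with ⟨rfl, rfl, rfl⟩ | ⟨rfl, rfl, rfl⟩ <;> simp
    · simp [h]
  · simp [controlTransitions] at h
    tauto

theorem source_ne_sink {q q' : State} {p : Primitive Msg}
    (h : (q, p, q') ∈ (simulator E start fin).T) : q ≠ sink := by
  rintro rfl
  rcases mem_T_iff.1 h with ⟨⟨s, op, t⟩, he, h⟩ | h
  · cases op <;> simp [edgeTransitions] at h
  · simp [controlTransitions] at h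

/-- The states in which a process has no part in the control of the simulation. -/
def State.passive : State → Bool
  | qin | pool | warden | unit _ => true
  | _ => false

/-- The processes that control the simulation: the leader and its partner in an increment or a
decrement, if things go well. -/
def core (C : Multiset State) : Multiset State := C.filter fun q => q.passive = false

/-- The values of the registers in a configuration. -/
def registers (C : Multiset State) : ℕ → ℕ := fun x => C.count (unit x)

theorem core_cons (q : State) (C : Multiset State) :
    core (q ::ₘ C) = if q.passive then core C else q ::ₘ core C := by
  cases h : q.passive <;> simp [core, h]

theorem registers_cons_of_ne {q : State} (h : ∀ x, q ≠ unit x) (C : Multiset State) :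
    registers (q ::ₘ C) = registers C :=
  funext fun x => Multiset.count_cons_of_ne (h x).symm C

theorem registers_cons_unit (x : ℕ) (C : Multiset State) :
    registers (unit x ::ₘ C) = update (registers C) x (registers C x + 1) := by
  funext y
  simp only [registers, Multiset.count_cons, update_apply, State.unit.injEq]
  grind

/-- The configurations in which at most one leader is at work and its run is faithful to the machine,
or was cut short by a request without a receiver (the case `core C = {wait s}`). A leader at work
comes with a warden, who would be lost in `sink` if a second leader were elected. -/
def Faithful (E : List Edge) (start : ℕ) (C : Multiset State) : Prop :=
  ((core C = 0 ∨ core C = {lead}) ∧ registers C = fun _ => 0) ∨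
  (warden ∈ C ∧
    ((∃ s, core C = {run s} ∧ Reaches E (start, fun _ => 0) (s, registers C)) ∨
    (∃ s, core C = {wait s}) ∨
    (∃ s x, core C = {wait s, up x} ∧
      Reaches E (start, fun _ => 0) (s, update (registers C) x (registers C x + 1))) ∨
    (∃ s, core C = {wait s, down} ∧ Reaches E (start, fun _ => 0) (s, registers C))))

theorem faithful_congr {C C' : Multiset State} (hc : core C' = core C)
    (hr : registers C' = registers C) (hg : warden ∈ C → warden ∈ C') (h : Faithful E start C) :
    Faithful E start C' := by
  unfold Faithful at h ⊢
  rw [hc, hr]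
  exact h.imp_right (And.imp_left hg)

theorem Faithful.of_qin_cons {D : Multiset State} (h : Faithful E start (qin ::ₘ D)) :
    Faithful E start D :=
  faithful_congr (by simp [core_cons, State.passive]) (by simp [registers_cons_of_ne]) (by simp) h

theorem Faithful.pool_cons {D : Multiset State} (h : Faithful E start D) :
    Faithful E start (pool ::ₘ D) :=
  faithful_congr (by simp [core_cons, State.passive]) (by simp [registers_cons_of_ne]) (by simp) h

theorem Faithful.warden_cons {D : Multiset State} (h : Faithful E start D) :
    Faithful E start (warden ::ₘ D) :=
  faithful_congr (by simp [core_cons, State.passive]) (by simp [registers_cons_of_ne]) (by simp) h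

theorem Faithful.of_lead_cons {D : Multiset State} (h : Faithful E start (lead ::ₘ D)) :
    core D = 0 ∧ registers D = fun _ => 0 := by
  simpa [Faithful, core_cons, State.passive, registers_cons_of_ne, Multiset.cons_eq_cons,
    ← Multiset.cons_zero] using h

theorem Faithful.of_run_cons {s : ℕ} {D : Multiset State} (h : Faithful E start (run s ::ₘ D)) :
    warden ∈ D ∧ core D = 0 ∧ Reaches E (start, fun _ => 0) (s, registers D) := by
  simp [Faithful, core_cons, State.passive, registers_cons_of_ne, Multiset.cons_eq_cons,
    ← Multiset.cons_zero] at h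
  grind

theorem Faithful.of_up_cons {x : ℕ} {D : Multiset State} (h : Faithful E start (up x ::ₘ D)) :
    warden ∈ D ∧ ∃ s, core D = {wait s} ∧
      Reaches E (start, fun _ => 0) (s, update (registers D) x (registers D x + 1)) := by
  simp [Faithful, core_cons, State.passive, registers_cons_of_ne, Multiset.cons_eq_cons,
    ← Multiset.cons_zero] at h
  simp [← Multiset.cons_zero]
  grind

theorem Faithful.of_down_cons {D : Multiset State} (h : Faithful E start (down ::ₘ D)) :
    warden ∈ D ∧ ∃ s, core D = {wait s} ∧ Reaches E (start, fun _ => 0) (s, registers D) := by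
  simp [Faithful, core_cons, State.passive, registers_cons_of_ne, Multiset.cons_eq_cons,
    ← Multiset.cons_zero] at h
  simp [← Multiset.cons_zero]
  grind

open Protocol (step_tau step_rendezvous step_nonblocking step_cases isInitial_iff isAllFinal_iff
  pair_add)

/-! ### Soundness of the simulation -/

/-- A step from a faithful configuration leads to a faithful one, unless the machine can reach its
final location or a process is lost in `sink`. -/
theorem Faithful.step {C C' : Multiset State} (h : Faithful E start C)
    (hst : (simulator E start fin).Step C C') :
    (∃ σ, Reaches E (start, fun _ => 0) (fin, σ)) ∨ sink ∈ C' ∨ Faithful E start C' := by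
  rcases step_cases hst with ⟨q, q', D, ht, rfl, rfl⟩ |
    ⟨m, q₁, q₁', q₂, q₂', D, hs, hr, rfl, rfl⟩ | ⟨m, q₁, q₁', D, hs, hn, rfl, rfl⟩
  · rcases tau_cases ht with ⟨rfl, rfl⟩ | ⟨s, t, he, rfl, rfl⟩ | ⟨rfl, rfl⟩
    · exact .inr (.inr h.of_qin_cons.pool_cons)
    · obtain ⟨hg, hc, hreach⟩ := h.of_run_cons
      refine .inr (.inr (.inr ⟨Multiset.mem_cons_of_mem hg, .inl ⟨t, ?_, ?_⟩⟩))
      · simp [core_cons, State.passive, hc]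
      · rw [registers_cons_of_ne (by simp)]
        exact hreach.tail ⟨.nop, he, rfl⟩
    · exact .inl ⟨_, h.of_run_cons.2.2⟩
  · rcases send_cases hs with ⟨rfl, rfl, rfl⟩ | ⟨rfl, rfl, rfl⟩ | ⟨rfl, rfl, rfl⟩ |
      ⟨s, x, t, he, rfl, rfl, rfl⟩ | ⟨s, x, t, he, rfl, rfl, rfl⟩ | ⟨s, x, t, he, rfl, rfl, rfl⟩ |
      ⟨x, rfl, rfl, rfl⟩ | ⟨rfl, rfl, rfl⟩
    · have := recv_cases hr
      simp only [reduceCtorEq, and_false, false_and, exists_false, false_or, or_false,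
        true_and] at this
      rcases this with ⟨-, rfl⟩ | ⟨-, rfl⟩ <;> simp
    · have := recv_cases hr
      simp only [reduceCtorEq, and_false, false_and, exists_false, or_false,
        true_and] at this
      obtain ⟨rfl, rfl⟩ := this
      obtain ⟨hc, hreg⟩ := h.of_qin_cons.of_lead_cons
      refine .inr (.inr (.inr ⟨Multiset.mem_cons_self _ _, .inl ⟨start, ?_, ?_⟩⟩))
      · simp [core_cons, State.passive, hc]
      · rw [registers_cons_of_ne (by simp), registers_cons_of_ne (by simp), hreg]
    · exact .inl ⟨_, h.of_run_cons.2.2⟩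
    · have := recv_cases hr
      simp only [reduceCtorEq, and_false, false_and, exists_false, false_or, or_false,
        Msg.inc.injEq] at this
      obtain ⟨y, rfl, rfl, rfl⟩ := this
      obtain ⟨hg, hc, hreach⟩ := h.of_run_cons
      simp only [Multiset.mem_cons, reduceCtorEq, false_or] at hg
      simp only [core_cons, State.passive, if_true] at hc
      rw [registers_cons_of_ne (by simp)] at hreach
      refine .inr (.inr (.inr ⟨by simp [hg], .inr (.inr (.inl ⟨t, x, ?_, ?_⟩))⟩))
      · simp [core_cons, State.passive, hc, ← Multiset.cons_zero]
      · rw [registers_cons_of_ne (by simp), registers_cons_of_ne (by simp)]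
        exact hreach.tail ⟨.inc x, he, rfl⟩
    · have := recv_cases hr
      simp only [reduceCtorEq, and_false, false_and, exists_false, false_or, or_false,
        Msg.dec.injEq] at this
      obtain ⟨y, rfl, rfl, rfl⟩ := this
      obtain ⟨hg, hc, hreach⟩ := h.of_run_cons
      simp only [Multiset.mem_cons, reduceCtorEq, false_or] at hg
      simp only [core_cons, State.passive, if_true] at hc
      rw [registers_cons_unit] at hreach
      refine .inr (.inr (.inr ⟨by simp [hg], .inr (.inr (.inr ⟨t, ?_, ?_⟩))⟩))
      · simp [core_cons, State.passive, hc, ← Multiset.cons_zero]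
      · rw [registers_cons_of_ne (by simp), registers_cons_of_ne (by simp)]
        exact hreach.tail ⟨.dec x, he, by simp, by simp⟩
    · have := recv_cases hr
      simp only [reduceCtorEq, and_false, false_and, exists_false, false_or,
        Msg.zero.injEq] at this
      obtain ⟨y, rfl, rfl, rfl⟩ := this
      simp
    · have := recv_cases hr
      simp only [reduceCtorEq, and_false, false_and, exists_false, false_or, or_false,
        true_and] at this
      obtain ⟨t, rfl, rfl⟩ := this
      obtain ⟨hg, s, hc, hreach⟩ := h.of_up_cons
      simp only [Multiset.mem_cons, reduceCtorEq, false_or] at hg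
      rw [registers_cons_of_ne (by simp)] at hreach
      simp only [core_cons, State.passive, Bool.false_eq_true, if_false, ← Multiset.cons_zero,
        Multiset.cons_eq_cons] at hc
      obtain ⟨⟨⟩, hcD⟩ : wait t = wait s ∧ core D = 0 := by simpa using hc
      refine .inr (.inr (.inr ⟨by simp [hg], .inl ⟨t, ?_, ?_⟩⟩))
      · simp [core_cons, State.passive, hcD]
      · rwa [registers_cons_unit, registers_cons_of_ne (by simp)]
    · have := recv_cases hr
      simp only [reduceCtorEq, and_false, false_and, exists_false, false_or, or_false,
        true_and] at this
      obtain ⟨t, rfl, rfl⟩ := this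
      obtain ⟨hg, s, hc, hreach⟩ := h.of_down_cons
      simp only [Multiset.mem_cons, reduceCtorEq, false_or] at hg
      rw [registers_cons_of_ne (by simp)] at hreach
      simp only [core_cons, State.passive, Bool.false_eq_true, if_false, ← Multiset.cons_zero,
        Multiset.cons_eq_cons] at hc
      obtain ⟨⟨⟩, hcD⟩ : wait t = wait s ∧ core D = 0 := by simpa using hc
      refine .inr (.inr (.inr ⟨by simp [hg], .inl ⟨t, ?_, ?_⟩⟩))
      · simp [core_cons, State.passive, hcD]
      · rwa [registers_cons_of_ne (by simp), registers_cons_of_ne (by simp)]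
  · rcases send_cases hs with ⟨rfl, rfl, rfl⟩ | ⟨rfl, rfl, rfl⟩ | ⟨rfl, rfl, rfl⟩ |
      ⟨s, x, t, he, rfl, rfl, rfl⟩ | ⟨s, x, t, he, rfl, rfl, rfl⟩ | ⟨s, x, t, he, rfl, rfl, rfl⟩ |
      ⟨x, rfl, rfl, rfl⟩ | ⟨rfl, rfl, rfl⟩
    -- Electing a leader fails to hit a warden or a leader only if no leader is at work.
    · have hg : warden ∉ D := hn _ _
        (mem_T_of_mem_control (t := (_, _, sink)) (by simp [controlTransitions]))
      have hl : lead ∉ D := hn _ _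
        (mem_T_of_mem_control (t := (_, _, sink)) (by simp [controlTransitions]))
      rcases h.of_qin_cons with ⟨hc | hc, hreg⟩ | ⟨hg', -⟩
      · refine .inr (.inr (.inl ⟨.inr ?_, ?_⟩))
        · simp [core_cons, State.passive, hc]
        · rwa [registers_cons_of_ne (by simp)]
      · refine absurd ?_ hl
        have : lead ∈ core D := by simp [hc]
        exact Multiset.mem_of_mem_filter this
      · exact absurd hg' hg
    · exact .inr (.inr h.of_qin_cons.warden_cons)
    · exact .inl ⟨_, h.of_run_cons.2.2⟩
    · obtain ⟨hg, hc, -⟩ := h.of_run_cons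
      refine .inr (.inr (.inr ⟨Multiset.mem_cons_of_mem hg, .inr (.inl ⟨t, ?_⟩)⟩))
      simp [core_cons, State.passive, hc]
    · obtain ⟨hg, hc, -⟩ := h.of_run_cons
      refine .inr (.inr (.inr ⟨Multiset.mem_cons_of_mem hg, .inr (.inl ⟨t, ?_⟩)⟩))
      simp [core_cons, State.passive, hc]
    · obtain ⟨hg, hc, hreach⟩ := h.of_run_cons
      have hz : unit x ∉ D := hn _ _
        (mem_T_of_mem_edge (t := (_, _, sink)) he (by simp [edgeTransitions]))
      refine .inr (.inr (.inr ⟨Multiset.mem_cons_of_mem hg, .inl ⟨t, ?_, ?_⟩⟩))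
      · simp [core_cons, State.passive, hc]
      · rw [registers_cons_of_ne (by simp)]
        exact hreach.tail ⟨.zero x, he, Multiset.count_eq_zero.2 hz, rfl⟩
    · obtain ⟨hg, s, hc, -⟩ := h.of_up_cons
      refine .inr (.inr (.inr ⟨Multiset.mem_cons_of_mem hg, .inr (.inl ⟨s, ?_⟩)⟩))
      simp [core_cons, State.passive, hc]
    · obtain ⟨hg, s, hc, -⟩ := h.of_down_cons
      refine .inr (.inr (.inr ⟨Multiset.mem_cons_of_mem hg, .inr (.inl ⟨s, ?_⟩)⟩))
      simp [core_cons, State.passive, hc]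

theorem sink_mem_of_step {C C' : Multiset State} (h : sink ∈ C)
    (hst : (simulator E start fin).Step C C') : sink ∈ C' := by
  rcases step_cases hst with ⟨q, q', D, ht, rfl, rfl⟩ |
    ⟨m, q₁, q₁', q₂, q₂', D, hs, hr, rfl, rfl⟩ | ⟨m, q₁, q₁', D, hs, hn, rfl, rfl⟩
  · have := (source_ne_sink ht).symm
    simp_all
  · have := (source_ne_sink hs).symm
    have := (source_ne_sink hr).symm
    simp_all
  · have := (source_ne_sink hs).symm
    simp_all

theorem reaches_of_synchro (h : (simulator E start fin).Synchro) :
    ∃ σ, Reaches E (start, fun _ => 0) (fin, σ) := by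
  obtain ⟨C₀, Cf, h₀, hf, hr⟩ := h
  rw [isInitial_iff] at h₀
  rw [isAllFinal_iff] at hf
  have hinv : (∃ σ, Reaches E (start, fun _ => 0) (fin, σ)) ∨ sink ∈ Cf ∨
      Faithful E start Cf := by
    clear hf
    induction hr with
    | refl =>
      refine .inr (.inr (.inl ⟨.inl ?_, ?_⟩))
      · refine Multiset.filter_eq_nil.2 fun q hq => ?_
        rw [h₀.2 q hq]
        simp [simulator, State.passive]
      · refine funext fun x => Multiset.count_eq_zero.2 fun hx => ?_
        exact absurd (h₀.2 _ hx) (by simp [simulator])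
    | tail _ hs ih =>
      rcases ih with h | h | h
      · exact .inl h
      · exact .inr (.inl (sink_mem_of_step h hs))
      · exact h.step hs
  rcases hinv with h | h | h
  · exact h
  · exact absurd (hf.2 _ h) (by simp [simulator])
  · exfalso
    -- No case of `Faithful` allows a process in `qf`: it would belong to the core.
    have hcore : core Cf = Cf := Multiset.filter_eq_self.2 fun q hq => by
      rw [hf.2 q hq]
      rfl
    have hmem : ∀ q, q ∈ core Cf → q = qf := fun q hq => hf.2 q (hcore ▸ hq)
    rcases h with ⟨h | h, -⟩ | ⟨hg, -⟩
    · exact hf.1 (hcore ▸ h)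
    · exact absurd (hmem lead (by simp [h])) (by simp)
    · exact absurd (hf.2 _ hg) (by simp [simulator])

/-! ### Completeness of the simulation -/

/-- The processes that the leader can release at the end of the simulation. -/
def Releasable (E : List Edge) (start fin : ℕ) (D : Multiset State) : Prop :=
  ∀ q ∈ D, (q, recv .release, qf) ∈ (simulator E start fin).T

/-- The simulator can follow each run of the machine with as many processes left in the pool as
desired. -/
theorem exists_simulation {c : ℕ × (ℕ → ℕ)} (h : Reaches E (start, fun _ => 0) c) (p : ℕ) :
    ∃ C₀ D, (simulator E start fin).IsInitial C₀ ∧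
      ReflTransGen (simulator E start fin).Step C₀ (run c.1 ::ₘ warden ::ₘ D) ∧
      Releasable E start fin D ∧ p ≤ D.count pool ∧ registers D = c.2 := by
  induction h generalizing p with
  | refl =>
    have hfill : ∀ (k : ℕ) (D : Multiset State), ReflTransGen (simulator E start fin).Step
        (Multiset.replicate k qin + D) (Multiset.replicate k pool + D) := by
      intro k
      induction k with
      | zero => exact fun D => .refl
      | succ k ih =>
        intro D
        have h1 : (simulator E start fin).Step (qin ::ₘ (Multiset.replicate k qin + D))
            (pool ::ₘ (Multiset.replicate k qin + D)) :=
          step_tau (mem_T_of_mem_control (by simp [controlTransitions]))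
        have h2 := ih (pool ::ₘ D)
        simp only [Multiset.add_cons] at h2
        simp only [Multiset.replicate_succ, Multiset.cons_add]
        exact .head h1 h2
    have hlead : (simulator E start fin).Step
        (qin ::ₘ qin ::ₘ Multiset.replicate p qin) (lead ::ₘ qin ::ₘ Multiset.replicate p qin) := by
      refine step_nonblocking (m := .elect)
        (mem_T_of_mem_control (by simp [controlTransitions])) fun q q' hr hq => ?_
      obtain rfl : q = qin := by
        rcases Multiset.mem_cons.1 hq with h | h
        · exact h
        · exact Multiset.eq_of_mem_replicate h
      have := recv_cases hr
      simp at this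
    have hguard : (simulator E start fin).Step
        (qin ::ₘ lead ::ₘ Multiset.replicate p qin)
        (warden ::ₘ run start ::ₘ Multiset.replicate p qin) :=
      step_rendezvous (m := .warden) (mem_T_of_mem_control (by simp [controlTransitions]))
        (mem_T_of_mem_control (by simp [controlTransitions]))
    have hpool := hfill p {warden, run start}
    refine ⟨qin ::ₘ qin ::ₘ Multiset.replicate p qin, Multiset.replicate p pool,
      isInitial_iff.2 ⟨by simp, ?_⟩, ?_, ?_, by simp, ?_⟩
    · intro q hq
      rcases Multiset.mem_cons.1 hq with h | hq
      · exact h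
      rcases Multiset.mem_cons.1 hq with h | hq
      · exact h
      · exact Multiset.eq_of_mem_replicate hq
    · rw [Multiset.cons_swap] at hguard
      rw [add_comm, pair_add, add_comm, pair_add, Multiset.cons_swap,
        Multiset.cons_swap warden] at hpool
      rw [Multiset.cons_swap warden] at hguard
      exact .head hlead (.head hguard hpool)
    · intro q hq
      rw [Multiset.eq_of_mem_replicate hq]
      exact mem_T_of_mem_control (by simp [controlTransitions])
    · funext x
      simp [registers, Multiset.count_replicate]
  | @tail c d _ hs ih =>
    obtain ⟨s, σ⟩ := c
    obtain ⟨t, τ⟩ := d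
    obtain ⟨op, he, hop⟩ := hs
    dsimp only at he hop ih ⊢
    cases op with
    | nop =>
      obtain ⟨C₀, D, h₀, hr, hD, hp, hreg⟩ := ih p
      refine ⟨C₀, D, h₀, hr.tail (step_tau (mem_T_of_mem_edge he ?_)), hD, hp, hreg.trans hop.symm⟩
      simp [edgeTransitions]
    | inc x =>
      obtain ⟨C₀, D, h₀, hr, hD, hp, hreg⟩ := ih (p + 1)
      obtain ⟨D, rfl⟩ := Multiset.exists_cons_of_mem (Multiset.count_pos.1 (p.succ_pos.trans_le hp))
      have h1 : (simulator E start fin).Step (run s ::ₘ pool ::ₘ warden ::ₘ D)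
          (wait t ::ₘ up x ::ₘ warden ::ₘ D) :=
        step_rendezvous (m := .inc x) (mem_T_of_mem_edge he (by simp [edgeTransitions]))
          (mem_T_of_mem_edge he (by simp [edgeTransitions]))
      have h2 : (simulator E start fin).Step (up x ::ₘ wait t ::ₘ warden ::ₘ D)
          (unit x ::ₘ run t ::ₘ warden ::ₘ D) :=
        step_rendezvous (m := .ack) (mem_T_of_mem_edge he (by simp [edgeTransitions]))
          (mem_T_of_mem_edge he (by simp [edgeTransitions]))
      rw [Multiset.cons_swap pool] at h1
      rw [Multiset.cons_swap (up x), Multiset.cons_swap (unit x), Multiset.cons_swap (unit x)] at h2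
      refine ⟨C₀, unit x ::ₘ D, h₀, (hr.tail h1).tail h2, ?_, ?_, ?_⟩
      · intro q hq
        rcases Multiset.mem_cons.1 hq with rfl | hq
        · exact mem_T_of_mem_edge he (by simp [edgeTransitions])
        · exact hD q (Multiset.mem_cons_of_mem hq)
      · simpa using hp
      · rw [registers_cons_of_ne (by simp)] at hreg
        rw [registers_cons_unit, hreg]
        exact hop.symm
    | dec x =>
      obtain ⟨C₀, D, h₀, hr, hD, hp, rfl⟩ := ih p
      obtain ⟨hpos, hop⟩ := hop
      obtain ⟨D, rfl⟩ := Multiset.exists_cons_of_mem (Multiset.count_pos.1 hpos)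
      have h1 : (simulator E start fin).Step (run s ::ₘ unit x ::ₘ warden ::ₘ D)
          (wait t ::ₘ down ::ₘ warden ::ₘ D) :=
        step_rendezvous (m := .dec x) (mem_T_of_mem_edge he (by simp [edgeTransitions]))
          (mem_T_of_mem_edge he (by simp [edgeTransitions]))
      have h2 : (simulator E start fin).Step (down ::ₘ wait t ::ₘ warden ::ₘ D)
          (pool ::ₘ run t ::ₘ warden ::ₘ D) :=
        step_rendezvous (m := .ack) (mem_T_of_mem_edge he (by simp [edgeTransitions]))
          (mem_T_of_mem_edge he (by simp [edgeTransitions]))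
      rw [Multiset.cons_swap (unit x)] at h1
      rw [Multiset.cons_swap down, Multiset.cons_swap pool, Multiset.cons_swap pool] at h2
      refine ⟨C₀, pool ::ₘ D, h₀, (hr.tail h1).tail h2, ?_, ?_, ?_⟩
      · intro q hq
        rcases Multiset.mem_cons.1 hq with rfl | hq
        · exact mem_T_of_mem_control (by simp [controlTransitions])
        · exact hD q (Multiset.mem_cons_of_mem hq)
      · rw [Multiset.count_cons_of_ne (by simp)] at hp
        rw [Multiset.count_cons_self]
        omega
      · rw [hop, registers_cons_unit, registers_cons_of_ne (by simp)]
        simp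
    | zero x =>
      obtain ⟨C₀, D, h₀, hr, hD, hp, rfl⟩ := ih p
      obtain ⟨hzero, hop⟩ := hop
      have h1 : (simulator E start fin).Step (run s ::ₘ warden ::ₘ D) (run t ::ₘ warden ::ₘ D) := by
        refine step_nonblocking (m := .zero x)
          (mem_T_of_mem_edge he (by simp [edgeTransitions])) fun q q' hr hq => ?_
        have := recv_cases hr
        simp only [reduceCtorEq, and_false, false_and, exists_false, false_or, Msg.zero.injEq] at this
        obtain ⟨y, rfl, rfl, -⟩ := this
        refine Multiset.count_eq_zero.1 hzero ?_
        simpa using hq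
      exact ⟨C₀, D, h₀, hr.tail h1, hD, hp, hop.symm⟩

theorem synchro_of_reaches {σ : ℕ → ℕ} (h : Reaches E (start, fun _ => 0) (fin, σ)) :
    (simulator E start fin).Synchro := by
  obtain ⟨C₀, D, h₀, hr, hD, -, -⟩ := exists_simulation (fin := fin) h 0
  have hrelease : ∀ (D F : Multiset State), Releasable E start fin D →
      ReflTransGen (simulator E start fin).Step (run fin ::ₘ (D + F))
        (run fin ::ₘ (Multiset.replicate D.card qf + F)) := by
    intro D
    induction D using Multiset.induction_on with
    | empty => exact fun F _ => .refl
    | cons q D ih =>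
      intro F hD
      have h1 : (simulator E start fin).Step (run fin ::ₘ q ::ₘ (D + F))
          (run fin ::ₘ qf ::ₘ (D + F)) :=
        step_rendezvous (m := .release) (mem_T_of_mem_control (by simp [controlTransitions]))
          (hD q (Multiset.mem_cons_self _ _))
      have h2 := ih (qf ::ₘ F) fun r hr => hD r (Multiset.mem_cons_of_mem hr)
      simp only [Multiset.add_cons] at h2
      simp only [Multiset.card_cons, Multiset.replicate_succ, Multiset.cons_add]
      exact .head h1 h2
  have hD' : Releasable E start fin (warden ::ₘ D) := by
    intro q hq
    rcases Multiset.mem_cons.1 hq with rfl | hq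
    · exact mem_T_of_mem_control (by simp [controlTransitions])
    · exact hD q hq
  have hend := hrelease (warden ::ₘ D) 0 hD'
  rw [add_zero, add_zero] at hend
  refine ⟨C₀, _, h₀, isAllFinal_iff.2 ⟨?_, ?_⟩, (hr.trans hend).tail
    (step_tau (mem_T_of_mem_control (t := (_, _, qf)) (by simp [controlTransitions])))⟩
  · simp
  · intro q hq
    rcases Multiset.mem_cons.1 hq with h | hq
    · exact h
    · exact Multiset.eq_of_mem_replicate hq

theorem simulator_synchro_iff : (simulator E start fin).Synchro ↔
    ∃ σ, Reaches E (start, fun _ => 0) (fin, σ) :=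
  ⟨reaches_of_synchro, fun ⟨_, h⟩ => synchro_of_reaches h⟩

/-- The states in which a process does not receive. -/
def State.active : State → Prop
  | qin | run _ | up _ | down => True
  | _ => False

theorem active_iff_of_mem_T {q q' : State} {p : Primitive Msg}
    (h : (q, p, q') ∈ (simulator E start fin).T) : q.active ↔ ∀ m, p ≠ recv m := by
  rcases mem_T_iff.1 h with ⟨⟨s, op, t⟩, he, h⟩ | h
  · cases op <;> simp only [edgeTransitions, List.mem_cons, Prod.mk.injEq, List.not_mem_nil,
      or_false] at h <;> grind [State.active]
  · simp only [controlTransitions, List.mem_cons, Prod.mk.injEq, List.not_mem_nil, or_false] at h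
    grind [State.active]

theorem simulator_waitOnly : (simulator E start fin).WaitOnly := by
  refine ⟨{q | q.active}, {q | q.active}ᶜ, Set.union_compl_self _, disjoint_compl_right, trivial,
    fun q hq m q' h => (active_iff_of_mem_T h).1 hq m rfl,
    fun q hq => ⟨fun m q' h => hq ((active_iff_of_mem_T h).2 (by simp)),
      fun q' h => hq ((active_iff_of_mem_T h).2 (by simp))⟩⟩

/-! ### Computing the protocol -/

/-- The numbers of the states. -/
def State.code : State → ℕ
  | .qin => 0
  | .sink => 1
  | .qf => 2
  | .warden => 3
  | .lead => 4
  | .pool => 5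
  | .down => 6
  | .up x => 4 * x + 7
  | .unit x => 4 * x + 8
  | .run s => 4 * s + 9
  | .wait s => 4 * s + 10

theorem State.code_injective : Injective State.code := by
  intro a b h
  cases a <;> cases b <;> simp only [State.code] at h <;> first | rfl | omega | (congr 1; omega)

/-- The numbers of the messages. -/
def Msg.code : Msg → ℕ
  | .elect => 0
  | .warden => 1
  | .ack => 2
  | .release => 3
  | .inc x => 3 * x + 4
  | .dec x => 3 * x + 5
  | .zero x => 3 * x + 6

theorem Msg.code_injective : Injective Msg.code := by
  intro a b h
  cases a <;> cases b <;> simp only [Msg.code] at h <;> first | rfl | omega | (congr 1; omega)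

/-- The codes of primitives over the alphabet `ℕ`, in accordance with `Primitive.code`. -/
def natPrimitiveCode : Primitive ℕ → Option (Bool × ℕ)
  | .tau => none
  | .send m => some (true, m)
  | .recv m => some (false, m)

theorem natPrimitiveCode_injective : Injective natPrimitiveCode := by
  intro a b h
  cases a <;> cases b <;> simp_all [natPrimitiveCode]

theorem natPrimitiveCode_map_val {k : ℕ} (p : Primitive (Fin k)) :
    natPrimitiveCode (p.map Fin.val) = p.code := by
  cases p <;> rfl

/-- The code of a transition of the simulating protocol. -/
def transitionCode (t : State × Primitive Msg × State) : ℕ × Option (Bool × ℕ) × ℕ :=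
  (t.1.code, natPrimitiveCode (t.2.1.map Msg.code), t.2.2.code)

/-- A raw protocol as a protocol with state set and alphabet `ℕ`. -/
def natProtocol (c : RawProtocol) : Protocol ℕ ℕ where
  qin := c.qin
  qf := c.qf
  T := {t | (t.1, natPrimitiveCode t.2.1, t.2.2) ∈ c.transitions}

/-- Forgetting the bounds on states and messages is a renaming of the protocol of an input. -/
theorem isRenaming_toProtocol (I : ProtocolInput) :
    I.toProtocol.IsRenaming (natProtocol I.val) Fin.val Fin.val where
  state_injective := Fin.val_injective
  message_injective := Fin.val_injective
  qin_eq := rfl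
  qf_eq := rfl
  mem_T_iff := by
    rintro ⟨q, p, q'⟩
    constructor
    · intro ht
      obtain ⟨hq, hq', hp⟩ := I.property.2.2 _ ht
      have hp' : ∃ r : Primitive (Fin I.val.numMessages), r.map Fin.val = p := by
        cases p with
        | tau => exact ⟨.tau, rfl⟩
        | send m => exact ⟨.send ⟨m, hp _ rfl⟩, rfl⟩
        | recv m => exact ⟨.recv ⟨m, hp _ rfl⟩, rfl⟩
      obtain ⟨r, rfl⟩ := hp'
      refine ⟨(⟨q, hq⟩, r, ⟨q', hq'⟩), ?_, rfl⟩
      simp only [natProtocol, natPrimitiveCode_map_val, Set.mem_ofPred_eq] at ht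
      exact ht
    · rintro ⟨⟨r, p, r'⟩, ht, h⟩
      rw [← h]
      simp only [natProtocol, natPrimitiveCode_map_val, Set.mem_ofPred_eq]
      exact ht

/-- The code of the protocol that simulates a counter machine, with `n` states and `k` messages. -/
def rawSimulator (n k : ℕ) (E : List Edge) (start fin : ℕ) : RawProtocol :=
  (n, k, State.qin.code, State.qf.code,
    (E.flatMap edgeTransitions ++ controlTransitions start fin).map transitionCode)

theorem isRenaming_rawSimulator (n k : ℕ) (E : List Edge) (start fin : ℕ) :
    (simulator E start fin).IsRenaming (natProtocol (rawSimulator n k E start fin))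
      State.code Msg.code where
  state_injective := State.code_injective
  message_injective := Msg.code_injective
  qin_eq := rfl
  qf_eq := rfl
  mem_T_iff := by
    rintro ⟨q, p, q'⟩
    constructor
    · intro ht
      obtain ⟨⟨r, p', r'⟩, hr, h⟩ := List.mem_map.1 ht
      simp only [transitionCode, Prod.mk.injEq] at h
      refine ⟨(r, p', r'), hr, ?_⟩
      simp only [h.1, h.2.2, natPrimitiveCode_injective h.2.1]
    · rintro ⟨u, hu, h⟩
      rw [← h]
      exact List.mem_map.2 ⟨u, hu, rfl⟩

/-- The states and the messages in the coded transition `t` have numbers below `n` and `k`. -/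
def Below (n k : ℕ) (t : ℕ × Option (Bool × ℕ) × ℕ) : Prop :=
  t.1 < n ∧ t.2.2 < n ∧ ∀ p ∈ t.2.1, p.2 < k

theorem Below.mono {n n' k k' : ℕ} (hn : n ≤ n') (hk : k ≤ k') {t : ℕ × Option (Bool × ℕ) × ℕ}
    (h : Below n k t) : Below n' k' t :=
  ⟨h.1.trans_le hn, h.2.1.trans_le hn, fun p hp => (h.2.2 p hp).trans_le hk⟩

theorem exists_below (l : List (ℕ × Option (Bool × ℕ) × ℕ)) : ∃ n, ∀ t ∈ l, Below n n t := by
  induction l with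
  | nil => exact ⟨0, by simp⟩
  | cons t l ih =>
    obtain ⟨n, hn⟩ := ih
    obtain ⟨k, hk⟩ : ∃ k, ∀ p ∈ t.2.1, p.2 < k := by
      cases h : t.2.1 with
      | none => exact ⟨0, by simp⟩
      | some p => exact ⟨p.2 + 1, by simp⟩
    refine ⟨n + k + t.1 + t.2.2 + 1, fun u hu => ?_⟩
    rcases List.mem_cons.1 hu with rfl | hu
    · exact ⟨by omega, by omega, fun p hp => by have := hk p hp; omega⟩
    · exact (hn u hu).mono (by omega) (by omega)

theorem rawSimulator_valid {n k : ℕ} {E : List Edge} {start fin : ℕ} (hn : 2 < n)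
    (hE : ∀ e ∈ E, ∀ t ∈ edgeTransitions e, Below n k (transitionCode t))
    (hc : ∀ t ∈ controlTransitions start fin, Below n k (transitionCode t)) :
    (rawSimulator n k E start fin).Valid := by
  refine ⟨Nat.zero_lt_of_lt hn, hn, fun t ht => ?_⟩
  obtain ⟨u, hu, rfl⟩ := List.mem_map.1 ht
  rcases List.mem_append.1 hu with hu | hu
  · obtain ⟨e, he, hu⟩ := List.mem_flatMap.1 hu
    exact hE e he u hu
  · exact hc u hu

/-- The coded transitions for the edges of a chain. -/
theorem map_transitionCode_chain (a m : ℕ) :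
    ((chain a m).flatMap edgeTransitions).map transitionCode = (List.range m).flatMap fun j =>
      [(4 * (a + j) + 9, some (true, 4), 4 * (a + j + 1) + 10),
        (4 * (a + j + 1) + 10, some (false, 2), 4 * (a + j + 1) + 9),
        (5, some (false, 4), 7), (7, some (true, 2), 8), (8, some (false, 3), 2)] := by
  simp only [chain, List.flatMap_map, List.map_flatMap]
  rfl

theorem primrec_rawSimulator (N : ℕ) (P : Prog) : Primrec fun m : ℕ =>
    rawSimulator (N + 4 * m) N (searchMachine P m) (P.size + 3) 1 := by
  have hadd : Primrec fun m : ℕ => N + 4 * m :=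
    Primrec.nat_add.comp (.const N) (Primrec.nat_mul.comp (.const 4) .id)
  have hlin : ∀ a b : ℕ, Primrec fun j : ℕ => 4 * (a + j) + b := fun a b =>
    Primrec.nat_add.comp (Primrec.nat_mul.comp (.const 4) (Primrec.nat_add.comp (.const a) .id))
      (.const b)
  have hlin' : ∀ a b : ℕ, Primrec fun j : ℕ => 4 * (a + j + 1) + b := fun a b =>
    (hlin (a + 1) b).of_eq fun j => by ring
  have hedge : ∀ a : ℕ, Primrec fun j : ℕ =>
      ([(4 * (a + j) + 9, some (true, 4), 4 * (a + j + 1) + 10),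
        (4 * (a + j + 1) + 10, some (false, 2), 4 * (a + j + 1) + 9),
        (5, some (false, 4), 7), (7, some (true, 2), 8), (8, some (false, 3), 2)] :
        List (ℕ × Option (Bool × ℕ) × ℕ)) := fun a =>
    Primrec.list_cons.comp ((hlin a 9).pair ((Primrec.const _).pair (hlin' a 10)))
      (Primrec.list_cons.comp ((hlin' a 10).pair ((Primrec.const _).pair (hlin' a 9)))
        (.const _))
  have hchain : ∀ a : ℕ, Primrec fun m : ℕ =>
      ((chain a m).flatMap edgeTransitions).map transitionCode := fun a =>
    (Primrec.list_flatMap Primrec.list_range ((hedge a).comp Primrec.snd).to₂).of_eq fun m =>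
      (map_transitionCode_chain a m).symm
  have hlast : ∀ a : ℕ, Primrec fun m : ℕ =>
      ([(4 * (a + m) + 9, none, 9)] : List (ℕ × Option (Bool × ℕ) × ℕ)) := fun a =>
    Primrec.list_cons.comp ((hlin a 9).pair (.const _)) (.const _)
  have htrans := Primrec.list_append.comp (Primrec.list_append.comp
    (.const (((searchCore P).flatMap edgeTransitions).map transitionCode))
    (Primrec.list_append.comp (hchain (P.size + 3)) (hlast (P.size + 3))))
    (.const ((controlTransitions (P.size + 3) 1).map transitionCode))
  refine (hadd.pair ((Primrec.const N).pair ((Primrec.const State.qin.code).pair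
    ((Primrec.const State.qf.code).pair htrans)))).of_eq fun m => ?_
  simp only [rawSimulator, searchMachine, List.flatMap_append, List.map_append]
  rfl

/-- The protocols that simulate the machines `searchMachine P m` are computed from `m`. -/
theorem exists_primrec_simulator (P : Prog) : ∃ r : ℕ → ProtocolInput, Primrec r ∧
    ∀ m, (simulator (searchMachine P m) (P.size + 3) 1).IsRenaming (natProtocol (r m).val)
      State.code Msg.code := by
  obtain ⟨N, hN⟩ := exists_below (((searchCore P).flatMap edgeTransitions ++
    controlTransitions (P.size + 3) 1).map transitionCode)
  have hvalid : ∀ m, (rawSimulator (N + 4 * (P.size + 3) + 15 + 4 * m)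
      (N + 4 * (P.size + 3) + 15) (searchMachine P m) (P.size + 3) 1).Valid := by
    intro m
    refine rawSimulator_valid (by omega) (fun e he t ht => ?_) fun t ht => ?_
    · rcases List.mem_append.1 he with he | he
      · exact (hN _ (List.mem_map_of_mem (List.mem_append_left _
          (List.mem_flatMap.2 ⟨e, he, ht⟩)))).mono (by omega) (by omega)
      rcases List.mem_append.1 he with he | he
      · obtain ⟨j, hj, rfl⟩ := List.mem_map.1 he
        rw [List.mem_range] at hj
        simp only [edgeTransitions, List.mem_cons, List.not_mem_nil, or_false] at ht
        rcases ht with rfl | rfl | rfl | rfl | rfl <;>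
          simp [Below, transitionCode, State.code, Msg.code, natPrimitiveCode, Primitive.map] <;>
          omega
      · rw [List.mem_singleton] at he
        subst he
        simp only [edgeTransitions, List.mem_cons, List.not_mem_nil, or_false] at ht
        subst ht
        simp [Below, transitionCode, State.code, natPrimitiveCode, Primitive.map]
        omega
    · exact (hN _ (List.mem_map_of_mem (List.mem_append_right _ ht))).mono (by omega) (by omega)
  exact ⟨fun m => ⟨_, hvalid m⟩, Primrec.subtype_mk (primrec_rawSimulator _ P),
    fun m => isRenaming_rawSimulator ..⟩

/-! ### The reduction from the halting problem -/

open Nat.Partrec (Code)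

/-- This is `0` if the program with the number `m` halts on the input `0` within the bound `k`, and
`1` otherwise. -/
def haltingTest (m k : ℕ) : ℕ :=
  bif (Code.evaln k (Denumerable.ofNat Code m) 0).isSome then 0 else 1

theorem primrec_haltingTest : Primrec₂ haltingTest :=
  Primrec.cond (Primrec.option_isSome.comp (Code.primrec_evaln.comp
    ((Primrec.snd.pair ((Primrec.ofNat Code).comp Primrec.fst)).pair (.const 0))))
    (.const 0) (.const 1)

theorem exists_haltingTest_eq_zero_iff (c : Code) :
    (∃ k, haltingTest (Encodable.encode c) k = 0) ↔ (Code.eval c 0).Dom := by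
  simp only [haltingTest, Denumerable.ofNat_encode, Part.dom_iff_mem, Code.evaln_complete]
  constructor
  · rintro ⟨k, h⟩
    cases hk : Code.evaln k c 0 with
    | none => simp [hk] at h
    | some x => exact ⟨x, k, hk⟩
  · rintro ⟨x, k, hk⟩
    exact ⟨k, by simp [Option.mem_def.1 hk]⟩

/-- The halting problem reduces to the synchronization problem for wait-only protocols. -/
theorem exists_reduction : ∃ r : Code → ProtocolInput, Computable r ∧
    ∀ c, (r c).toProtocol.WaitOnly ∧ ((r c).toProtocol.Synchro ↔ (Code.eval c 0).Dom) := by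
  obtain ⟨P, hP⟩ := computes_of_primrec' (Nat.Primrec'.prim_iff₂.2 primrec_haltingTest)
    (ins := ![0, 1]) (o := 2) (b := 3) (by simp [Fin.forall_fin_two]) (by simp [Fin.forall_fin_two])
    (by simp)
  have hP' : ∀ m k, Exec P (inputStore m k) (update (inputStore m k) 2 (haltingTest m k)) := by
    intro m k
    refine (hP (inputStore m k) (fun y hy => ?_) ?_).of_eq ?_
    · simp only [inputStore]; grind
    · simp only [inputStore]; grind
    · rfl
  obtain ⟨r, hr, hren⟩ := exists_primrec_simulator P
  refine ⟨fun c => r (Encodable.encode c), (hr.comp Primrec.encode).to_comp, fun c => ⟨?_, ?_⟩⟩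
  · rw [← (isRenaming_toProtocol _).waitOnly_iff, (hren _).waitOnly_iff]
    exact simulator_waitOnly
  · rw [← (isRenaming_toProtocol _).synchro_iff, (hren _).synchro_iff, simulator_synchro_iff,
      ← exists_haltingTest_eq_zero_iff]
    exact ⟨fun ⟨_, h⟩ => exists_eq_zero_of_searchMachine_reaches hP' h,
      fun ⟨_, h⟩ => searchMachine_reaches hP' h⟩

theorem not_decidableOn_waitOnly :
    ¬ DecidableOn {I : ProtocolInput | I.toProtocol.WaitOnly}
        (fun I : ProtocolInput => I.toProtocol.Synchro) := by
  rintro ⟨f, hf, hdec⟩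
  obtain ⟨r, hr, hred⟩ := exists_reduction
  classical
  refine ComputablePred.halting_problem 0 ⟨inferInstance, (hf.comp hr).of_eq fun c => ?_⟩
  obtain ⟨b, hb, hbs⟩ := hdec (r c) (hred c).1
  have : b = decide (Code.eval c 0).Dom := by
    rw [Bool.eq_iff_iff]
    exact hbs.trans ((hred c).2.trans decide_eq_true_iff.symm)
  rw [hb, this]
  rfl

end Simulation

theorem mainTheorem6 :
    ¬ ComputablePred (fun I : ProtocolInput => I.toProtocol.Synchro) ∧
    ¬ DecidableOn {I : ProtocolInput | I.toProtocol.WaitOnly}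
        (fun I : ProtocolInput => I.toProtocol.Synchro) := by
  refine ⟨?_, Simulation.not_decidableOn_waitOnly⟩
  rintro ⟨_, hd⟩
  exact Simulation.not_decidableOn_waitOnly
    ⟨_, hd, fun I _ => ⟨decide I.toProtocol.Synchro, rfl, decide_eq_true_iff⟩⟩
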